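/- **Dyck paths and Tamari intervals.** A Dyck path of size $n$ is a word with $n$ letters $u$ (up) and $n$ letters $d$ (down) all of whose prefixes contain at least as many $u$ as $d$; the empty path $\bullet$ has size $0$. A contact of $P$ is a point of $P$ at height $0$; let $c_0(P)$ be the number of contacts other than the initial point, and for $i\ge 1$ let $c_i(P)$ be the number of non-initial contacts of the maximal Dyck path that follows the $i$-th up step of $P$. The type of $P$ is the vector $(\mathbf 1_{c_0(P)>0},\dots,\mathbf 1_{c_n(P)>0})$. A right rotation replaces $P=V\,d\,P_1\,W$ by $V\,P_1\,d\,W$, where $P_1$ is a non-empty Dyck path that returns to height $0$ only at its end; the Tamari order $\preceq$ is the reflexive transitive closure of right rotation. A Tamari interval of size $n$ is a pair $I=[P,Q]$ of Dyck paths of size $n$ with $P\preceq Q$; put $c_0(I)=c_0(P)$, and let $L(I)$ be the largest $k$ for which there is a strictly increasing chain $P=D_0\prec D_1\prec\dots\prec D_k=Q$. The interval is synchronized if $P$ and $Q$ have the same type. For $1\le i\le c_0(I)+1$, the pointed interval $I^{\bullet i}=[P^\ell\cdot P^r,Q]$ is $I$ together with the factorization $P=P^\ell P^r$ at the $i$-th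 contact of $P$ counted from right to left (all contacts are counted). The left composition of $I_1^{\bullet i}=[P_1^\ell\cdot P_1^r,Q_1]$ and $I_2=[P_2,Q_2]$ is the Tamari interval $$\oplus_{\mathcal I}(I_1^{\bullet i},I_2)=[\,u P_1^\ell d\,P_1^r P_2,\ u Q_1 d\,Q_2\,].$$ **Extended fighting fish.** Fighting fish are the words that can be obtained from $ENWS$ (the head, one cell) by finitely many gluings of one cell each, which replace a factor $W$ by $NWS$, or a factor $N$ by $ENW$, or a factor $WN$ by $NW$; in addition, the empty fish $\varepsilon=EVS$ (with no cell) counts as a fighting fish. Extended fighting fish are $\varepsilon$ and the words obtained from a non-empty fighting fish by replacing some (possibly none) of its factors $WN$ by a letter $V$. The size of $F$ is $|F|_E+|F|_N-1$. The jaw length $\operatorname{jaw}(F)$ is $0$ if $F=\varepsilon$, and otherwise the number of letters $E$ before the first other letter. The area of $F$ is its number of cells (the letters $V$, which stand for triangles, do not count); equivalently $\operatorname{area}(F)=\sum_i(\operatorname{lat}(F^{\le i})-\operatorname{lat}(F^{\le i-1}))\operatorname{long}(F^{\le i})$, where $F^{\le i}$ is the prefix of length $i$, $\operatorname{lat}(w)=|w|_N-|w|_S+|w|_V$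 and $\operatorname{long}(w)=|w|_E-|w|_W-|w|_V$. The concatenation is $F_1\odot F_2=E^{j}G_1G_2$ for non-empty $F_1=G_1S$ and $F_2=E^{j}NG_2$ with $j=\operatorname{jaw}(F_2)$, and $F\odot\varepsilon=\varepsilon\odot F=F$. For $1\le i\le j+1$, where $j=\operatorname{jaw}(F)$, the $i$-augmentation of a non-empty $F=E^{j}NG$ is $A_i(F)=E^iNE^{j-i}NGS$ if $i\le j$ and $A_{j+1}(F)=E^{j+1}NVGS$; moreover $A_1(\varepsilon)=ENWS$. The low composition is $\oplus_{\mathcal F}(F_1^{\bullet i},F_2)=A_i(F_1)\odot F_2$, for $1\le i\le\operatorname{jaw}(F_1)+1$. **Theorem.** There is exactly one map $\Phi$ from the set of all Tamari intervals to the set of all extended fighting fish such that $\Phi([\bullet,\bullet])=\varepsilon$ and, for every pointed Tamari interval $I_1^{\bullet i}$ and every Tamari interval $I_2$, one has $1\le i\le\operatorname{jaw}(\Phi(I_1))+1$ and $$\Phi\big(\oplus_{\mathcal I}(I_1^{\bullet i},I_2)\big)=\oplus_{\mathcal F}\big(\Phi(I_1)^{\bullet i},\Phi(I_2)\big).$$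 This map $\Phi$ is a bijection. For every $n\ge 0$ and every Tamari interval $I$ of size $n$, the fish $\Phi(I)$ has size $n$, $\operatorname{jaw}(\Phi(I))=c_0(I)$ and $\operatorname{area}(\Phi(I))=L(I)+n$ (whether the area is computed by the displayed formula or as the number of cells in any construction of the fish). Moreover, $\Phi$ restricts to a bijection from the set of synchronized Tamari intervals onto the set of fighting fish, $\varepsilon$ included. -/

import Mathlib

/-! ### Dyck paths and the Tamari order

Dyck paths are Mathlib's `DyckWord`s: `p + q` is the concatenation `PQ`, `0` is the empty path,
`p.nest` is `u P d`, and `p.semilength` is the size. -/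

namespace TamariFish

/-- `q` covers `p`: `p = V d P₁ W` and `q = V P₁ d W` as words, where `P₁` is a non-empty Dyck path
that returns to the axis only at its end. -/
def RightRotation (p q : DyckWord) : Prop :=
  ∃ (v w : List DyckStep) (p₁ : DyckWord), p₁.IsNested ∧
    p.toList = v ++ [DyckStep.D] ++ p₁.toList ++ w ∧
    q.toList = v ++ p₁.toList ++ [DyckStep.D] ++ w

/-- The Tamari order `≼`: reachability through right rotations (possibly none). -/
def TamariLE (p q : DyckWord) : Prop := Relation.ReflTransGen RightRotation p q

/-- The strict Tamari order. -/
def TamariLT (p q : DyckWord) : Prop := TamariLE p q ∧ p ≠ q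

/-- `returns h l`: follow the steps of `l` from height `h`, stopping as soon as the walk would go
below height `0`; count the steps that end at height `0`. -/
def returns : ℕ → List DyckStep → ℕ
  | _, [] => 0
  | h, DyckStep.U :: l => returns (h + 1) l
  | 0, DyckStep.D :: _ => 0
  | 1, DyckStep.D :: l => returns 0 l + 1
  | h + 2, DyckStep.D :: l => returns (h + 1) l

/-- For every up step of a word, in order, the number of non-initial contacts of the (maximal) Dyck
path that follows it. -/
def contactsAfterUps : List DyckStep → List ℕ
  | [] => []
  | DyckStep.U :: l => returns 0 l :: contactsAfterUps l
  | DyckStep.D :: l => contactsAfterUps l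

/-- `c₀(P)`: the number of non-initial contacts of `P`. -/
def contacts (p : DyckWord) : ℕ := returns 0 p.toList

/-- The contact vector `(c₀(P), …, cₙ(P))`. -/
def contactVector (p : DyckWord) : List ℕ := contacts p :: contactsAfterUps p.toList

/-- The type of `P`: the vector of the truth values of `cᵢ(P) > 0`. -/
def pathType (p : DyckWord) : List Bool := (contactVector p).map (fun c => decide (0 < c))

/-! Facts on rotations that are needed to form the compositions of intervals and to see that the
Tamari distance is a maximum. -/

theorem RightRotation.context {p q : DyckWord} (h : RightRotation p q) {p' q' : DyckWord}
    (a b : List DyckStep) (hp : p'.toList = a ++ p.toList ++ b)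
    (hq : q'.toList = a ++ q.toList ++ b) : RightRotation p' q' := by
  obtain ⟨v, w, p₁, h₁, h₂, h₃⟩ := h
  exact ⟨a ++ v, w ++ b, p₁, h₁, by simp [hp, h₂], by simp [hq, h₃]⟩

theorem TamariLE.add_right {p q : DyckWord} (h : TamariLE p q) (r : DyckWord) :
    TamariLE (p + r) (q + r) :=
  Relation.ReflTransGen.lift (r := RightRotation) (p := RightRotation) (fun x : DyckWord => x + r)
    (fun _ _ hab => RightRotation.context hab [] r.toList rfl rfl) _ _ h

theorem TamariLE.add_left {p q : DyckWord} (h : TamariLE p q) (r : DyckWord) :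
    TamariLE (r + p) (r + q) :=
  Relation.ReflTransGen.lift (r := RightRotation) (p := RightRotation) (fun x : DyckWord => r + x)
    (fun a b hab => RightRotation.context hab r.toList []
      (List.append_nil (r + a).toList).symm (List.append_nil (r + b).toList).symm) _ _ h

theorem TamariLE.nest {p q : DyckWord} (h : TamariLE p q) : TamariLE p.nest q.nest :=
  Relation.ReflTransGen.lift (r := RightRotation) (p := RightRotation) (fun x : DyckWord => x.nest)
    (fun _ _ hab => RightRotation.context hab [DyckStep.U] [DyckStep.D] rfl rfl) _ _ h

theorem rightRotation_nest_add (l a b : DyckWord) :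
    RightRotation (l.nest + (a.nest + b)) ((l + a.nest).nest + b) :=
  ⟨DyckStep.U :: l.toList, b.toList, a.nest, .nest,
    show ([DyckStep.U] ++ l.toList ++ [DyckStep.D]) ++ (a.nest.toList ++ b.toList) = _ by simp,
    show ([DyckStep.U] ++ (l.toList ++ a.nest.toList) ++ [DyckStep.D]) ++ b.toList = _ by simp⟩

theorem tamariLE_nest_add (l r : DyckWord) : TamariLE (l.nest + r) (l + r).nest := by
  by_cases hr : r = 0
  · subst hr
    simp only [add_zero]
    exact Relation.ReflTransGen.refl
  · have h := DyckWord.nest_insidePart_add_outsidePart hr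
    have hlt := DyckWord.semilength_outsidePart_lt hr
    have ih := tamariLE_nest_add (l + r.insidePart.nest) r.outsidePart
    rw [add_assoc, h] at ih
    refine Relation.ReflTransGen.head ?_ ih
    have := rightRotation_nest_add l r.insidePart r.outsidePart
    rwa [h] at this
termination_by r.semilength

/-- For every down step the number of up steps before it, summed, with `c` up steps already made. -/
def upsBeforeDowns : ℕ → List DyckStep → ℕ
  | _, [] => 0
  | c, DyckStep.U :: l => upsBeforeDowns (c + 1) l
  | c, DyckStep.D :: l => c + upsBeforeDowns c l

theorem upsBeforeDowns_append (c : ℕ) (a b : List DyckStep) :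
    upsBeforeDowns c (a ++ b) = upsBeforeDowns c a + upsBeforeDowns (c + a.count DyckStep.U) b := by
  induction a generalizing c with
  | nil => simp [upsBeforeDowns]
  | cons x l ih =>
    cases x <;> simp [upsBeforeDowns, ih, add_assoc, add_comm 1]

theorem RightRotation.lt {p q : DyckWord} (h : RightRotation p q) :
    upsBeforeDowns 0 p.toList < upsBeforeDowns 0 q.toList := by
  obtain ⟨v, w, p₁, h₁, h₂, h₃⟩ := h
  have hpos : 0 < p₁.toList.count DyckStep.U := by
    rw [List.count_pos_iff, ← DyckWord.head_eq_U p₁ (DyckWord.toList_ne_nil.mpr h₁.1)]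
    exact List.head_mem _
  rw [h₂, h₃]
  simp [upsBeforeDowns_append, upsBeforeDowns]
  omega

theorem TamariLE.eq_or_lt {p q : DyckWord} (h : TamariLE p q) :
    p = q ∨ upsBeforeDowns 0 p.toList < upsBeforeDowns 0 q.toList := by
  induction h with
  | refl => exact Or.inl rfl
  | tail _ hbc ih =>
    right
    rcases ih with rfl | ih
    · exact hbc.lt
    · exact ih.trans hbc.lt

/-! ### Tamari intervals -/

/-- A Tamari interval `[P, Q]`, of arbitrary size. -/
@[ext]
structure TamariInterval where
  lower : DyckWord
  upper : DyckWord
  le : TamariLE lower upper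

namespace TamariInterval

def size (I : TamariInterval) : ℕ := I.lower.semilength

/-- The interval `[•, •]` of size `0`. -/
def empty : TamariInterval := ⟨0, 0, Relation.ReflTransGen.refl⟩

/-- `c₀(I) = c₀(P)` for `I = [P, Q]`. -/
def c₀ (I : TamariInterval) : ℕ := contacts I.lower

def IsSynchronized (I : TamariInterval) : Prop := pathType I.lower = pathType I.upper

/-- The numbers `k` for which there is a chain `P = D₀ < D₁ < ⋯ < D_k = Q` in the Tamari order. -/
def chainLengths (I : TamariInterval) : Set ℕ :=
  {k | ∃ D : ℕ → DyckWord, D 0 = I.lower ∧ D k = I.upper ∧ ∀ i < k, TamariLT (D i) (D (i + 1))}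

/-- The Tamari distance `L(I)`: the largest number of steps of a strictly increasing chain from
`P` to `Q`. It is a maximum: see `isGreatest_distance`. -/
noncomputable def distance (I : TamariInterval) : ℕ := sSup I.chainLengths

theorem isGreatest_distance (I : TamariInterval) : IsGreatest I.chainLengths I.distance := by
  have hne : I.chainLengths.Nonempty := by
    by_cases h : I.lower = I.upper
    · exact ⟨0, fun _ => I.lower, rfl, h, fun i hi => absurd hi (Nat.not_lt_zero i)⟩
    · refine ⟨1, fun i => if i = 0 then I.lower else I.upper, by simp, by simp, fun i hi => ?_⟩
      obtain rfl : i = 0 := by omega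
      simpa using ⟨I.le, h⟩
  have hbdd : BddAbove I.chainLengths := by
    refine ⟨upsBeforeDowns 0 I.upper.toList, ?_⟩
    rintro k ⟨D, -, hk, hD⟩
    have key : ∀ i, i ≤ k → i ≤ upsBeforeDowns 0 (D i).toList := by
      intro i
      induction i with
      | zero => exact fun _ => Nat.zero_le _
      | succ i ih =>
        intro hi
        have h₁ := ih (by omega)
        have h₂ := (hD i (by omega)).1.eq_or_lt.resolve_left (hD i (by omega)).2
        omega
    simpa [hk] using key k le_rfl
  exact ⟨Nat.sSup_mem hne hbdd, fun k hk => le_csSup hbdd hk⟩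

/-- Concatenation `I₁ ⊙ I₂ = [P₁P₂, Q₁Q₂]`. -/
def concat (I₁ I₂ : TamariInterval) : TamariInterval where
  lower := I₁.lower + I₂.lower
  upper := I₁.upper + I₂.upper
  le := Relation.ReflTransGen.trans (I₁.le.add_right I₂.lower) (I₂.le.add_left I₁.upper)

end TamariInterval

/-- A pointed Tamari interval `[Pˡ · Pʳ, Q]`: a contact of the lower path is distinguished and splits
it into two Dyck paths. -/
structure PointedInterval where
  interval : TamariInterval
  left : DyckWord
  right : DyckWord
  split : interval.lower = left + right

namespace PointedInterval

/-- The `i` of the notation `I^{•i}`: the distinguished contact is the `i`-th contact of the lower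
path counted from right to left (all contacts count, the two end points included). -/
def index (J : PointedInterval) : ℕ := contacts J.right + 1

/-- The augmentation `[u Pˡ d Pʳ, u Q d]`. -/
def augment (J : PointedInterval) : TamariInterval where
  lower := J.left.nest + J.right
  upper := J.interval.upper.nest
  le := Relation.ReflTransGen.trans (tamariLE_nest_add J.left J.right)
    (J.split ▸ J.interval.le.nest)

/-- The left composition `⊕(I₁^{•i}, I₂)`: the augmentation of `I₁^{•i}` concatenated with `I₂`. -/
def leftComposition (J : PointedInterval) (I₂ : TamariInterval) : TamariInterval :=
  J.augment.concat I₂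

end PointedInterval

/-! ### Extended fighting fish -/

/-- The letters that code the free edges (`E`: left lower, `N`: right lower, `W`: right upper,
`S`: left upper) and the triangles (`V`) met in the counterclockwise tour of a fish. -/
inductive FishStep
  | E | N | W | S | V
  deriving DecidableEq

open FishStep

/-- `Built k w`: the word `w` can be obtained from the head `ENWS` by gluings of cells, the fish
having `k` cells, the head included. -/
inductive Built : ℕ → List FishStep → Prop
  | head : Built 1 [E, N, W, S]
  | upper {k : ℕ} (a b : List FishStep) : Built k (a ++ [W] ++ b) →
      Built (k + 1) (a ++ [N, W, S] ++ b)
  | lower {k : ℕ} (a b : List FishStep) : Built k (a ++ [N] ++ b) →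
      Built (k + 1) (a ++ [E, N, W] ++ b)
  | double {k : ℕ} (a b : List FishStep) : Built k (a ++ [W, N] ++ b) →
      Built (k + 1) (a ++ [N, W] ++ b)

/-- The word of the empty fish `ε`. -/
def emptyWord : List FishStep := [E, V, S]

/-- Removal of the triangles: every letter `V` becomes `WN`. -/
def unmark (w : List FishStep) : List FishStep :=
  w.flatMap fun x => if x = V then [W, N] else [x]

/-- Words of fighting fish: those that can be built from the head, and the empty fish. -/
def IsFish (w : List FishStep) : Prop := w = emptyWord ∨ ∃ k, Built k w

/-- Words of extended fighting fish: those obtained from a word built from the head by replacing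
some factors `WN` by `V` (equivalently, the words that give it back when each `V` is replaced by
`WN`), and the empty fish. -/
def IsExtFish (w : List FishStep) : Prop := w = emptyWord ∨ ∃ k, Built k (unmark w)

/-- Extended fighting fish. -/
abbrev ExtFish : Type := {w : List FishStep // IsExtFish w}

/-- The empty fish `ε`. -/
def ExtFish.empty : ExtFish := ⟨emptyWord, Or.inl rfl⟩

/-- The number of free lower edges minus one. -/
def fishSize (w : List FishStep) : ℤ := w.count E + w.count N - 1

/-- The jaw length: `0` for the empty fish, otherwise the length of the initial run of `E`. -/
def jaw (w : List FishStep) : ℕ :=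
  if w = emptyWord then 0 else (w.takeWhile (fun x => decide (x = E))).length

def lat (w : List FishStep) : ℤ := w.count N - w.count S + w.count V

def long (w : List FishStep) : ℤ := w.count E - w.count W - w.count V

/-- The area enclosed by the walk, by the shoelace formula. -/
def area (w : List FishStep) : ℤ :=
  ∑ i ∈ Finset.range w.length, (lat (w.take (i + 1)) - lat (w.take i)) * long (w.take (i + 1))

/-- The fish with word `w` consists of `k` cells (triangles are not counted, and the empty fish has
no cell). -/
def HasCells (w : List FishStep) (k : ℕ) : Prop :=
  (w = emptyWord ∧ k = 0) ∨ Built k (unmark w)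

/-- Concatenation `F₁ ⊙ F₂`: for non-empty `F₁ = G₁ S` and `F₂ = E^j N G₂`, with `j` the jaw length
of `F₂`, it is `E^j G₁ G₂`. -/
def fishConcat (w₁ w₂ : List FishStep) : List FishStep :=
  if w₁ = emptyWord then w₂
  else if w₂ = emptyWord then w₁
  else List.replicate (jaw w₂) E ++ w₁.dropLast ++ w₂.drop (jaw w₂ + 1)

/-- The `i`-augmentation, meant for `1 ≤ i ≤ j + 1` with `j` the jaw length: for a non-empty
`F = E^j N G` it is `E^i N E^(j-i) N G S` if `i ≤ j`, and `E^(j+1) N V G S` if `i = j + 1`. -/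
def fishAugment (i : ℕ) (w : List FishStep) : List FishStep :=
  if w = emptyWord then [E, N, W, S]
  else if i ≤ jaw w then
    List.replicate i E ++ [N] ++ List.replicate (jaw w - i) E ++ [N] ++ w.drop (jaw w + 1) ++ [S]
  else List.replicate (jaw w + 1) E ++ [N, V] ++ w.drop (jaw w + 1) ++ [S]

/-- The low composition `⊕(F₁^{•i}, F₂)`. -/
def lowComposition (i : ℕ) (w₁ w₂ : List FishStep) : List FishStep :=
  fishConcat (fishAugment i w₁) w₂

/-- The recursive definition of `Φ`. The second clause contains the condition under which the right
hand side is meaningful: `Φ(I₁)` can be pointed at the index `i` of `I₁^{•i}`. -/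
structure FishRecursion (Φ : TamariInterval → ExtFish) : Prop where
  empty : Φ TamariInterval.empty = ExtFish.empty
  composition : ∀ (J : PointedInterval) (I₂ : TamariInterval),
    (1 ≤ J.index ∧ J.index ≤ jaw (Φ J.interval).1 + 1) ∧
    (Φ (J.leftComposition I₂)).1 = lowComposition J.index (Φ J.interval).1 (Φ I₂).1

end TamariFish

/-!
Non-empty Tamari intervals and non-empty extended fighting fish both decompose uniquely as
compositions of smaller objects, and the parameters behave in the same way under the two
compositions. Everything about `Φ` follows by induction.

*Intervals.* A rotation of `u l d r` either moves the down step between `l` and `r` over the first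
prime factor of `r`, or takes place within `l` or within `r` (`RightRotation.of_nest_add`). Read
backwards, a chain of rotations that ends in `Q₁ Q₂` splits into two independent chains
(`RotationChain.to_add`), and a chain from `u l d r` to `u Q d` becomes a chain from `l r` to `Q` when
the moves of the down step are forgotten; there are at most as many of these moves as `r` has
non-initial contacts (`RotationChain.to_nest`). This gives the decomposition of an interval and the
formula `L(⊕(I₁, I₂)) = L(I₁) + c₀(Pʳ) + L(I₂)`, the maximum being attained by making all the moves
of the down step first.

*Fish.* A non-empty fish is a word `E^j N w`, with `j > 0` its jaw length, where `w` satisfies a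
grammar, `Closes`. Its state is the list of the lengths of the horizontal strips of cells that the
tour has still to go down along; when a letter `N` opens a new strip, the number of cells of the
current strip under it is guessed. Each gluing of a cell replaces a factor by one that can be read
from every state that accepted the old one, with the same final state, so that all fish satisfy the
grammar (`Built.opens`). Conversely, the rules of the grammar are the low compositions
(`Closes.exists_eq_lowTail`), and fish are closed under these, with `k₁ + i + k₂` cells for the
composition at index `i` of fish with `k₁` and `k₂` cells (`Built.lowTail`). Low composition is
injective (`lowTail_inj`) as the words that close a strip form a prefix code. The shoelace formula
grows by `1` with each gluing and does not see the difference between `V` and `WN`, so the number of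
cells is determined by the word (`Built.area_eq`, `area_unmark`).

The map is obtained from the relation `Corr` generated by the two compositions. A low composition
introduces a letter `V` exactly when the first fish is non-empty and the index is its jaw length plus
one. For intervals this says that `Pˡ` is empty while `Q₁` is not, and then the types of
`u Pˡ d Pʳ P₂` and `u Q₁ d Q₂` differ at the first up step; in the other cases these types agree if
and only if those of the two components do.
-/

namespace TamariFish

open FishStep

/-! ### Walks and Dyck words -/

/-- The final height of the walk with steps `l` from height `h`, or `none` if it goes below `0`. -/
def walk : ℕ → List DyckStep → Option ℕ
  | h, [] => some h
  | h, DyckStep.U :: l => walk (h + 1) l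
  | 0, DyckStep.D :: _ => none
  | h + 1, DyckStep.D :: l => walk h l

theorem walk_append (h : ℕ) (a b : List DyckStep) :
    walk h (a ++ b) = (walk h a).bind fun k => walk k b := by
  induction a generalizing h with
  | nil => rfl
  | cons x a ih => cases x <;> cases h <;> simp [walk, ih]

theorem walk_add {h k : ℕ} {l : List DyckStep} (c : ℕ) (hl : walk h l = some k) :
    walk (h + c) l = some (k + c) := by
  induction l generalizing h with
  | nil => simp_all [walk]
  | cons x l ih =>
    cases x with
    | U =>
      have := ih (h := h + 1) hl
      rwa [add_right_comm] at this
    | D =>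
      cases h with
      | zero => simp [walk] at hl
      | succ h =>
        rw [add_right_comm]
        exact ih (h := h) hl

theorem walk_eq_some_iff {h k : ℕ} {l : List DyckStep} :
    walk h l = some k ↔ h + l.count DyckStep.U = k + l.count DyckStep.D ∧
      ∀ i, (l.take i).count DyckStep.D ≤ h + (l.take i).count DyckStep.U := by
  induction l generalizing h with
  | nil => simp [walk]
  | cons x l ih =>
    cases x with
    | U =>
      simp only [walk, ih]
      refine and_congr (by simp; omega) ⟨fun H i => ?_, fun H i => ?_⟩
      · cases i with
        | zero => simp
        | succ i => have := H i; simp; omega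
      · have := H (i + 1); simp at this; omega
    | D =>
      cases h with
      | zero =>
        simp only [walk, reduceCtorEq, false_iff, not_and, not_forall]
        exact fun _ => ⟨1, by simp⟩
      | succ h =>
        simp only [walk, ih]
        refine and_congr (by simp; omega) ⟨fun H i => ?_, fun H i => ?_⟩
        · cases i with
          | zero => simp
          | succ i => have := H i; simp; omega
        · have := H (i + 1); simp at this; omega

theorem walk_toList (p : DyckWord) : walk 0 p.toList = some 0 :=
  walk_eq_some_iff.2 ⟨by simpa using p.count_U_eq_count_D, by simpa using p.count_D_le_count_U⟩

theorem exists_toList_eq {l : List DyckStep} (h : walk 0 l = some 0) :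
    ∃ p : DyckWord, p.toList = l := by
  obtain ⟨h₁, h₂⟩ := walk_eq_some_iff.1 h
  exact ⟨⟨l, by simpa using h₁, by simpa using h₂⟩, rfl⟩

theorem toList_zero : (0 : DyckWord).toList = [] := rfl

theorem toList_add (p q : DyckWord) : (p + q).toList = p.toList ++ q.toList := rfl

theorem toList_nest (p : DyckWord) : p.nest.toList = DyckStep.U :: (p.toList ++ [DyckStep.D]) := rfl

theorem toList_nest_add (l r : DyckWord) :
    (l.nest + r).toList = DyckStep.U :: (l.toList ++ DyckStep.D :: r.toList) := by
  simp [toList_add, toList_nest]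

theorem nest_add_inj {l r l' r' : DyckWord} :
    l.nest + r = l'.nest + r' ↔ l = l' ∧ r = r' := by
  refine ⟨fun h => ⟨?_, ?_⟩, fun h => by rw [h.1, h.2]⟩
  · simpa using congrArg DyckWord.insidePart h
  · simpa using congrArg DyckWord.outsidePart h

theorem dyckWord_induction {motive : DyckWord → Prop} (zero : motive 0)
    (nest_add : ∀ l r, motive l → motive r → motive (l.nest + r)) (p : DyckWord) : motive p := by
  by_cases hp : p = 0
  · rwa [hp]
  · have h₁ := DyckWord.semilength_insidePart_lt hp
    have h₂ := DyckWord.semilength_outsidePart_lt hp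
    rw [← DyckWord.nest_insidePart_add_outsidePart hp]
    exact nest_add _ _ (dyckWord_induction zero nest_add _) (dyckWord_induction zero nest_add _)
termination_by p.semilength

theorem exists_nest_add_of_ne_zero {p : DyckWord} (hp : p ≠ 0) :
    ∃ l r : DyckWord, p = l.nest + r :=
  ⟨_, _, (DyckWord.nest_insidePart_add_outsidePart hp).symm⟩

/-- Exchanging a down step and a Dyck word that follows it keeps a walk above the axis. -/
theorem walk_rotate {v w : List DyckStep} {p₁ : DyckWord} {h k : ℕ}
    (H : walk h (v ++ DyckStep.D :: (p₁.toList ++ w)) = some k) :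
    walk h (v ++ p₁.toList ++ DyckStep.D :: w) = some k := by
  have key (c : ℕ) : walk c p₁.toList = some c := by simpa using walk_add c (walk_toList p₁)
  simp only [walk_append, Option.bind_eq_some_iff] at H ⊢
  obtain ⟨a, ha, H⟩ := H
  cases a with
  | zero => simp [walk] at H
  | succ a =>
    simp only [walk, walk_append, key, Option.bind_some] at H
    exact ⟨a + 1, ⟨a + 1, ha, key _⟩, H⟩

/-! ### Rotations and the first return decomposition -/

theorem RightRotation.nest_add {l l' : DyckWord} (h : RightRotation l l') (r : DyckWord) :
    RightRotation (l.nest + r) (l'.nest + r) :=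
  h.context [DyckStep.U] (DyckStep.D :: r.toList) (by simp [toList_nest_add])
    (by simp [toList_nest_add])

theorem RightRotation.add_left {r r' : DyckWord} (h : RightRotation r r') (l : DyckWord) :
    RightRotation (l + r) (l + r') :=
  h.context l.toList [] (by simp [toList_add]) (by simp [toList_add])

theorem RightRotation.add_right {l l' : DyckWord} (h : RightRotation l l') (r : DyckWord) :
    RightRotation (l + r) (l' + r) :=
  h.context [] r.toList (by simp [toList_add]) (by simp [toList_add])

theorem RightRotation.nest {l l' : DyckWord} (h : RightRotation l l') :
    RightRotation l.nest l'.nest := by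
  simpa using h.nest_add 0

/-- The rotations of `u l d r`: either the down step that ends `u l d` moves over the first prime
factor of `r`, or the rotation takes place within `l` or within `r`. -/
theorem RightRotation.of_nest_add {l r q : DyckWord} (h : RightRotation (l.nest + r) q) :
    (∃ a b : DyckWord, r = a.nest + b ∧ q = (l + a.nest).nest + b) ∨
    (∃ l', RightRotation l l' ∧ q = l'.nest + r) ∨
    (∃ r', RightRotation r r' ∧ q = l.nest + r') := by
  obtain ⟨v, w, p₁, h₁, h₂, h₃⟩ := h
  rw [toList_nest_add] at h₂
  have hl := walk_toList l
  have hr := walk_toList r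
  have hp := walk_toList p₁
  -- the down step of the rotation is the one that ends `u l d`
  have merge : v = DyckStep.U :: l.toList → r.toList = p₁.toList ++ w →
      ∃ a b : DyckWord, r = a.nest + b ∧ q = (l + a.nest).nest + b := by
    intro hv hw
    rw [hw, walk_append, hp] at hr
    obtain ⟨b, hb⟩ := exists_toList_eq (l := w) (by simpa using hr)
    refine ⟨p₁.denest h₁, b, ?_, ?_⟩
    · rw [DyckWord.nest_denest]
      ext1
      rw [toList_add, hw, hb]
    · rw [DyckWord.nest_denest]
      ext1
      simp [h₃, hv, toList_nest, toList_add, hb]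
  cases v with
  | nil => simp at h₂
  | cons x v =>
    simp only [List.cons_append, List.append_assoc, List.cons.injEq, List.nil_append] at h₂
    obtain ⟨rfl, h₂⟩ := h₂
    rcases List.append_eq_append_iff.1 h₂ with ⟨c, hv, hc⟩ | ⟨c, hv, hc⟩
    · cases c with
      | nil =>
        simp only [List.append_nil, List.nil_append, List.cons.injEq, true_and] at hv hc
        exact Or.inl (merge (by rw [hv]) hc)
      | cons y c =>
        simp only [List.cons_append, List.cons.injEq] at hc
        obtain ⟨rfl, hc⟩ := hc
        right; right
        have hr' := hr
        rw [hc] at hr'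
        obtain ⟨r', hr'⟩ := exists_toList_eq (walk_rotate hr')
        refine ⟨r', ⟨c, w, p₁, h₁, by simp [hc], by simp [hr']⟩, ?_⟩
        ext1
        simp [h₃, toList_nest_add, hv, hr']
    · cases c with
      | nil =>
        simp only [List.append_nil, List.nil_append, List.cons.injEq, true_and] at hv hc
        exact Or.inl (merge (by rw [hv]) hc.symm)
      | cons y c =>
        simp only [List.cons_append, List.cons.injEq] at hc
        obtain ⟨rfl, hc⟩ := hc
        have inside (t : List DyckStep) (ht : c = p₁.toList ++ t)
            (hw : w = t ++ DyckStep.D :: r.toList) :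
            ∃ l', RightRotation l l' ∧ q = l'.nest + r := by
          rw [hv, ht] at hl
          obtain ⟨l', hl'⟩ := exists_toList_eq (walk_rotate hl)
          refine ⟨l', ⟨v, t, p₁, h₁, by simp [hv, ht], by simp [hl']⟩, ?_⟩
          ext1
          simp [h₃, toList_nest_add, hl', hw]
        right; left
        rcases List.append_eq_append_iff.1 hc with ⟨t, ht, hw⟩ | ⟨t, ht, hw⟩
        · exact inside t ht hw
        · cases t with
          | nil =>
            simp only [List.append_nil, List.nil_append] at ht hw
            exact inside [] (by simp [ht]) (by simp [hw])
          | cons y t =>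
            simp only [List.cons_append, List.cons.injEq] at hw
            obtain ⟨rfl, hw⟩ := hw
            -- `p₁` would contain the down step that ends `u l d`, where the walk is on the axis
            exfalso
            rw [hv, walk_append, Option.bind_eq_some_iff] at hl
            obtain ⟨k, hk, hl⟩ := hl
            cases k with
            | zero => simp [walk] at hl
            | succ k =>
              simp only [walk] at hl
              have := walk_add k hp
              rw [ht, walk_append, zero_add, hl] at this
              simp [walk] at this

theorem RightRotation.semilength_eq {p q : DyckWord} (h : RightRotation p q) :
    p.semilength = q.semilength := by
  obtain ⟨v, w, p₁, -, h₂, h₃⟩ := h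
  simp [DyckWord.semilength, h₂, h₃]

/-- The rotations that end in `u l d r`. -/
theorem RightRotation.to_nest_add {p l r : DyckWord} (h : RightRotation p (l.nest + r)) :
    (∃ l' a : DyckWord, l = l' + a.nest ∧ p = l'.nest + (a.nest + r)) ∨
    (∃ l', RightRotation l' l ∧ p = l'.nest + r) ∨
    (∃ r', RightRotation r' r ∧ p = l.nest + r') := by
  have hp : p ≠ 0 := by
    rintro rfl
    have := h.semilength_eq
    simp at this
    omega
  obtain ⟨x, y, rfl⟩ := exists_nest_add_of_ne_zero hp
  rcases h.of_nest_add with ⟨a, b, rfl, hq⟩ | ⟨x', hx, hq⟩ | ⟨y', hy, hq⟩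
  · obtain ⟨rfl, rfl⟩ := nest_add_inj.1 hq
    exact Or.inl ⟨x, a, rfl, rfl⟩
  · obtain ⟨rfl, rfl⟩ := nest_add_inj.1 hq
    exact Or.inr (Or.inl ⟨x, hx, rfl⟩)
  · obtain ⟨rfl, rfl⟩ := nest_add_inj.1 hq
    exact Or.inr (Or.inr ⟨y, hy, rfl⟩)

theorem RightRotation.to_add {p q₁ q₂ : DyckWord} (h : RightRotation p (q₁ + q₂)) :
    (∃ p₁, RightRotation p₁ q₁ ∧ p = p₁ + q₂) ∨ (∃ p₂, RightRotation p₂ q₂ ∧ p = q₁ + p₂) := by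
  induction q₁ using dyckWord_induction generalizing p with
  | zero => exact Or.inr ⟨p, by simpa using h, by simp⟩
  | nest_add l r _ ih =>
    rw [add_assoc] at h
    rcases h.to_nest_add with ⟨l', a, rfl, rfl⟩ | ⟨l', hl, rfl⟩ | ⟨r', hr, rfl⟩
    · exact Or.inl ⟨_, rightRotation_nest_add l' a r, by simp [add_assoc]⟩
    · exact Or.inl ⟨_, hl.nest_add r, by simp [add_assoc]⟩
    · rcases ih hr with ⟨p₁, h₁, rfl⟩ | ⟨p₂, h₂, rfl⟩
      · exact Or.inl ⟨_, h₁.add_left _, by simp [add_assoc]⟩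
      · exact Or.inr ⟨_, h₂, by simp [add_assoc]⟩

/-! ### Contacts -/

theorem returns_append {k h : ℕ} {l m : List DyckStep} (hl : walk k l = some h) :
    returns k (l ++ m) = returns k l + returns h m := by
  induction l generalizing k with
  | nil => simp_all [walk, returns]
  | cons x l ih =>
    cases x with
    | U => exact ih hl
    | D =>
      match k with
      | 0 => simp [walk] at hl
      | 1 =>
        have := ih (k := 0) hl
        simp only [List.cons_append, returns, this]
        omega
      | k + 2 => exact ih (k := k + 1) hl

theorem returns_add_one {k h : ℕ} {l : List DyckStep} (hl : walk k l = some h) :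
    returns (k + 1) l = 0 := by
  induction l generalizing k with
  | nil => rfl
  | cons x l ih =>
    cases x with
    | U => exact ih hl
    | D =>
      cases k with
      | zero => simp [walk] at hl
      | succ k => exact ih hl

theorem contacts_zero : contacts 0 = 0 := rfl

theorem contacts_add (p q : DyckWord) : contacts (p + q) = contacts p + contacts q :=
  returns_append (walk_toList p)

theorem contacts_nest (p : DyckWord) : contacts p.nest = 1 := by
  have h₁ : walk 1 p.toList = some 1 := by simpa using walk_add 1 (walk_toList p)
  simp only [contacts, toList_nest, returns]
  rw [zero_add, returns_append h₁, returns_add_one (walk_toList p)]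
  rfl

theorem contacts_nest_add (l r : DyckWord) : contacts (l.nest + r) = contacts r + 1 := by
  rw [contacts_add, contacts_nest, add_comm]

theorem contacts_eq_zero {p : DyckWord} : contacts p = 0 ↔ p = 0 := by
  refine ⟨fun h => ?_, fun h => by rw [h, contacts_zero]⟩
  by_contra hp
  obtain ⟨l, r, rfl⟩ := exists_nest_add_of_ne_zero hp
  simp [contacts_nest_add] at h

theorem RightRotation.contacts_le {p q : DyckWord} (h : RightRotation p q) :
    contacts q ≤ contacts p := by
  induction p using dyckWord_induction generalizing q with
  | zero =>
    obtain ⟨v, w, p₁, -, h₂, -⟩ := h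
    simp [toList_zero] at h₂
  | nest_add l r _ ih =>
    rcases h.of_nest_add with ⟨a, b, rfl, rfl⟩ | ⟨l', hl, rfl⟩ | ⟨r', hr, rfl⟩
    · simp [contacts_nest_add]
    · simp [contacts_nest_add]
    · simpa [contacts_nest_add] using ih hr

/-- A factorization of a Dyck word is determined by the number of contacts of its right factor. -/
theorem eq_of_add_eq_add_of_contacts {l r l' r' : DyckWord} (h : l + r = l' + r')
    (hc : contacts r = contacts r') : l = l' ∧ r = r' := by
  induction l using dyckWord_induction generalizing l' with
  | zero =>
    have := congrArg contacts h
    simp only [contacts_add, contacts_zero] at this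
    have hl' : l' = 0 := contacts_eq_zero.1 (by omega)
    subst hl'
    exact ⟨rfl, by simpa using h⟩
  | nest_add a b _ ih =>
    by_cases hl' : l' = 0
    · have := congrArg contacts h
      simp only [contacts_add, contacts_nest, hl', contacts_zero] at this
      omega
    · obtain ⟨a', b', rfl⟩ := exists_nest_add_of_ne_zero hl'
      rw [add_assoc, add_assoc, nest_add_inj] at h
      obtain ⟨rfl, hb⟩ := h
      obtain ⟨rfl, rfl⟩ := ih hb
      exact ⟨rfl, rfl⟩

theorem exists_add_contacts_eq (p : DyckWord) {c : ℕ} (hc : c ≤ contacts p) :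
    ∃ l r, p = l + r ∧ contacts r = c := by
  induction p using dyckWord_induction with
  | zero =>
    have : c = 0 := by simpa [contacts_zero] using hc
    exact ⟨0, 0, by simp, by simp [this, contacts_zero]⟩
  | nest_add a b _ ih =>
    rw [contacts_nest_add] at hc
    rcases hc.lt_or_eq with h | h
    · obtain ⟨l, r, rfl, hr⟩ := ih (by omega)
      exact ⟨a.nest + l, r, by simp [add_assoc], hr⟩
    · exact ⟨0, a.nest + b, by simp, by rw [contacts_nest_add, h]⟩

/-- A factorization of a Dyck word is determined by the size of its right factor. -/
theorem eq_of_add_eq_add_of_semilength {l r l' r' : DyckWord} (h : l + r = l' + r')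
    (hs : r.semilength = r'.semilength) : l = l' ∧ r = r' := by
  have h₁ := congrArg DyckWord.toList h
  rw [toList_add, toList_add] at h₁
  obtain ⟨h₂, h₃⟩ := List.append_inj' h₁ (by
    rw [← DyckWord.two_mul_semilength_eq_length, ← DyckWord.two_mul_semilength_eq_length, hs])
  exact ⟨DyckWord.ext h₂, DyckWord.ext h₃⟩

/-! ### Types -/

theorem returns_append_of_walk_eq_none {k : ℕ} {l m : List DyckStep} (hl : walk k l = none) :
    returns k (l ++ m) = returns k l := by
  induction l generalizing k with
  | nil => simp [walk] at hl
  | cons x l ih =>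
    cases x with
    | U => exact ih hl
    | D =>
      match k with
      | 0 => rfl
      | 1 => exact congrArg (· + 1) (ih (k := 0) hl)
      | k + 2 => exact ih (k := k + 1) hl

/-- The Dyck path that follows an up step of a Dyck word ends within this word, hence does not
depend on what follows. -/
theorem contactsAfterUps_append {k : ℕ} {l : List DyckStep} (hl : walk k l = some 0)
    (m : List DyckStep) :
    contactsAfterUps (l ++ m) = contactsAfterUps l ++ contactsAfterUps m := by
  induction l generalizing k with
  | nil => rfl
  | cons x l ih =>
    cases x with
    | U =>
      have hn : walk 0 l = none := by
        by_contra hn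
        obtain ⟨c, hc⟩ := Option.ne_none_iff_exists'.1 hn
        have h₁ := walk_add (k + 1) hc
        rw [zero_add] at h₁
        simp only [walk] at hl
        rw [hl] at h₁
        simp at h₁
      simp only [List.cons_append, contactsAfterUps]
      rw [returns_append_of_walk_eq_none hn, ih (k := k + 1) hl]
    | D =>
      cases k with
      | zero => simp [walk] at hl
      | succ k => exact ih (k := k) hl

theorem length_contactsAfterUps (l : List DyckStep) :
    (contactsAfterUps l).length = l.count DyckStep.U := by
  induction l with
  | nil => rfl
  | cons x l ih => cases x <;> simp [contactsAfterUps, ih]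

/-- The type of a Dyck word without its first entry, which tells if the word is non-empty. -/
def upType (p : DyckWord) : List Bool := (contactsAfterUps p.toList).map fun c => decide (0 < c)

theorem length_upType (p : DyckWord) : (upType p).length = p.semilength := by
  simp [upType, length_contactsAfterUps, DyckWord.semilength]

theorem upType_add (p q : DyckWord) : upType (p + q) = upType p ++ upType q := by
  simp [upType, toList_add, contactsAfterUps_append (walk_toList p)]

theorem upType_nest_add (l r : DyckWord) :
    upType (l.nest + r) = decide (0 < contacts l) :: (upType l ++ upType r) := by
  have h : returns 0 (l.toList ++ DyckStep.D :: r.toList) = contacts l := by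
    rw [returns_append (walk_toList l)]
    simp [returns, contacts]
  simp [upType, toList_nest_add, contactsAfterUps, contactsAfterUps_append (walk_toList l), h]

theorem pathType_eq (p : DyckWord) : pathType p = decide (0 < contacts p) :: upType p := rfl

theorem pathType_eq_iff {p q : DyckWord} (h : p.semilength = q.semilength) :
    pathType p = pathType q ↔ upType p = upType q := by
  have key (p : DyckWord) : 0 < contacts p ↔ 0 < p.semilength := by
    by_cases hp : p = 0
    · simp [hp, contacts_zero]
    · obtain ⟨l, r, rfl⟩ := exists_nest_add_of_ne_zero hp
      simp [contacts_nest_add]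
  simp [pathType_eq, key, h]

/-! ### Chains of rotations -/

/-- `RotationChain n p q`: the word `q` is obtained from `p` by `n` successive right rotations. -/
inductive RotationChain : ℕ → DyckWord → DyckWord → Prop
  | refl (p : DyckWord) : RotationChain 0 p p
  | head {n : ℕ} {p q r : DyckWord} :
      RightRotation p q → RotationChain n q r → RotationChain (n + 1) p r

namespace RotationChain

theorem trans {m n : ℕ} {p q r : DyckWord} (h₁ : RotationChain m p q) (h₂ : RotationChain n q r) :
    RotationChain (m + n) p r := by
  induction h₁ with
  | refl p => simpa using h₂
  | head h _ ih =>
    rw [add_right_comm]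
    exact head h (ih h₂)

theorem map {f : DyckWord → DyckWord}
    (hf : ∀ p q, RightRotation p q → RightRotation (f p) (f q)) {n : ℕ} {p q : DyckWord}
    (h : RotationChain n p q) : RotationChain n (f p) (f q) := by
  induction h with
  | refl p => exact refl _
  | head h _ ih => exact head (hf _ _ h) ih

theorem tamariLE {n : ℕ} {p q : DyckWord} (h : RotationChain n p q) : TamariLE p q := by
  induction h with
  | refl p => exact Relation.ReflTransGen.refl
  | head h _ ih => exact Relation.ReflTransGen.head h ih

theorem semilength_eq {n : ℕ} {p q : DyckWord} (h : RotationChain n p q) :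
    p.semilength = q.semilength := by
  induction h with
  | refl p => rfl
  | head h _ ih => exact h.semilength_eq.trans ih

theorem eq_of_zero {p q : DyckWord} (h : RotationChain 0 p q) : p = q := by
  cases h
  rfl

theorem add {m n : ℕ} {p₁ p₂ q₁ q₂ : DyckWord} (h₁ : RotationChain m p₁ q₁)
    (h₂ : RotationChain n p₂ q₂) : RotationChain (m + n) (p₁ + p₂) (q₁ + q₂) :=
  (h₁.map (f := (· + p₂)) fun _ _ h => h.add_right p₂).trans
    (h₂.map (f := (q₁ + ·)) fun _ _ h => h.add_left q₁)

theorem nest {n : ℕ} {p q : DyckWord} (h : RotationChain n p q) : RotationChain n p.nest q.nest :=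
  h.map (f := DyckWord.nest) fun _ _ h => h.nest

theorem nest_add (l r : DyckWord) : RotationChain (contacts r) (l.nest + r) (l + r).nest := by
  induction r using dyckWord_induction generalizing l with
  | zero => simpa [contacts_zero] using refl l.nest
  | nest_add a b _ ih =>
    rw [contacts_nest_add, ← add_assoc l]
    exact head (rightRotation_nest_add l a b) (ih _)

/-- A chain that ends in a concatenation takes place in the two factors independently. -/
theorem to_add {n : ℕ} {p q₁ q₂ : DyckWord} (h : RotationChain n p (q₁ + q₂)) :
    ∃ p₁ p₂ n₁ n₂, p = p₁ + p₂ ∧ n = n₁ + n₂ ∧ RotationChain n₁ p₁ q₁ ∧ RotationChain n₂ p₂ q₂ := by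
  generalize hq : q₁ + q₂ = q at h
  induction h with
  | refl p => exact ⟨q₁, q₂, 0, 0, hq.symm, rfl, refl _, refl _⟩
  | head h _ ih =>
    obtain ⟨p₁, p₂, n₁, n₂, rfl, rfl, h₁, h₂⟩ := ih hq
    rcases h.to_add with ⟨p', h', rfl⟩ | ⟨p', h', rfl⟩
    · exact ⟨p', p₂, n₁ + 1, n₂, rfl, by omega, head h' h₁, h₂⟩
    · exact ⟨p₁, p', n₁, n₂ + 1, rfl, by omega, h₁, head h' h₂⟩

/-- In a chain from `u l d r` to `u q d`, the rotations that move the down step between `l` and `r`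
leave `l r` unchanged and lower the number of contacts of `r`; the other rotations form a chain
from `l r` to `q`. -/
theorem to_nest {n : ℕ} {p q : DyckWord} (h : RotationChain n p q.nest) :
    ∃ l r n', p = l.nest + r ∧ RotationChain n' (l + r) q ∧ n ≤ n' + contacts r := by
  generalize hq : q.nest = q' at h
  induction h with
  | refl p => exact ⟨q, 0, 0, by simp [hq], by simpa using refl q, by simp⟩
  | head h _ ih =>
    obtain ⟨l, r, n', rfl, h₁, hn⟩ := ih hq
    rcases h.to_nest_add with ⟨l', a, rfl, rfl⟩ | ⟨l', hl, rfl⟩ | ⟨r', hr, rfl⟩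
    · refine ⟨l', a.nest + r, n', rfl, by rwa [← add_assoc], ?_⟩
      rw [contacts_nest_add]
      omega
    · exact ⟨l', r, n' + 1, rfl, head (hl.add_right r) h₁, by omega⟩
    · have := hr.contacts_le
      exact ⟨l, r', n' + 1, rfl, head (hr.add_left l) h₁, by omega⟩

end RotationChain

theorem TamariLE.exists_rotationChain {p q : DyckWord} (h : TamariLE p q) :
    ∃ n, RotationChain n p q := by
  induction h using Relation.ReflTransGen.head_induction_on with
  | refl => exact ⟨0, .refl _⟩
  | head h _ ih =>
    obtain ⟨n, hn⟩ := ih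
    exact ⟨n + 1, .head h hn⟩

theorem RightRotation.tamariLT {p q : DyckWord} (h : RightRotation p q) : TamariLT p q :=
  ⟨Relation.ReflTransGen.single h, fun hpq => (hpq ▸ h.lt).ne rfl⟩

namespace TamariInterval

theorem semilength_eq (I : TamariInterval) : I.lower.semilength = I.upper.semilength :=
  I.le.exists_rotationChain.choose_spec.semilength_eq

theorem isSynchronized_iff (I : TamariInterval) :
    I.IsSynchronized ↔ upType I.lower = upType I.upper :=
  pathType_eq_iff I.semilength_eq

theorem mem_chainLengths {I : TamariInterval} {n : ℕ} (h : RotationChain n I.lower I.upper) :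
    n ∈ I.chainLengths := by
  have key {n : ℕ} {p q : DyckWord} (h : RotationChain n p q) :
      ∃ D : ℕ → DyckWord, D 0 = p ∧ D n = q ∧ ∀ i < n, TamariLT (D i) (D (i + 1)) := by
    induction h with
    | refl p => exact ⟨fun _ => p, rfl, rfl, by simp⟩
    | @head n p q r h _ ih =>
      obtain ⟨D, h₀, h₁, hD⟩ := ih
      refine ⟨fun i => i.casesOn p D, rfl, h₁, fun i hi => ?_⟩
      cases i with
      | zero => simpa [h₀] using h.tamariLT
      | succ i => exact hD i (by omega)
  exact key h

theorem exists_rotationChain_of_mem {I : TamariInterval} {k : ℕ} (hk : k ∈ I.chainLengths) :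
    ∃ n, k ≤ n ∧ RotationChain n I.lower I.upper := by
  obtain ⟨D, h₀, h₁, hD⟩ := hk
  have key (i : ℕ) (hi : i ≤ k) : ∃ n, i ≤ n ∧ RotationChain n (D 0) (D i) := by
    induction i with
    | zero => exact ⟨0, le_rfl, .refl _⟩
    | succ i ih =>
      obtain ⟨n, hn, h⟩ := ih (by omega)
      obtain ⟨hle, hne⟩ := hD i (by omega)
      obtain ⟨m, hm⟩ := hle.exists_rotationChain
      cases m with
      | zero => exact absurd hm.eq_of_zero hne
      | succ m => exact ⟨n + (m + 1), by omega, h.trans hm⟩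
  rw [← h₀, ← h₁]
  exact key k le_rfl

theorem exists_rotationChain_distance (I : TamariInterval) :
    RotationChain I.distance I.lower I.upper := by
  obtain ⟨n, hn, h⟩ := exists_rotationChain_of_mem I.isGreatest_distance.1
  rwa [le_antisymm hn (I.isGreatest_distance.2 (mem_chainLengths h))]

theorem _root_.TamariFish.RotationChain.le_distance {I : TamariInterval} {n : ℕ}
    (h : RotationChain n I.lower I.upper) : n ≤ I.distance :=
  I.isGreatest_distance.2 (mem_chainLengths h)

theorem distance_empty : empty.distance = 0 := by
  have h := exists_rotationChain_distance empty
  generalize empty.distance = d at h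
  cases h with
  | refl => rfl
  | head h _ =>
    obtain ⟨v, w, p₁, -, h₂, -⟩ := h
    simp [empty, toList_zero] at h₂

end TamariInterval

/-! ### The decomposition of Tamari intervals -/

namespace PointedInterval

theorem lower_leftComposition (J : PointedInterval) (I₂ : TamariInterval) :
    (J.leftComposition I₂).lower = J.left.nest + (J.right + I₂.lower) :=
  add_assoc _ _ _

theorem upper_leftComposition (J : PointedInterval) (I₂ : TamariInterval) :
    (J.leftComposition I₂).upper = J.interval.upper.nest + I₂.upper := rfl

theorem size_leftComposition (J : PointedInterval) (I₂ : TamariInterval) :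
    (J.leftComposition I₂).size = J.interval.size + I₂.size + 1 := by
  have h : J.interval.lower.semilength = _ := congrArg DyckWord.semilength J.split
  rw [DyckWord.semilength_add] at h
  simp only [TamariInterval.size, lower_leftComposition, DyckWord.semilength_add,
    DyckWord.semilength_nest, h]
  omega

theorem c₀_interval (J : PointedInterval) :
    J.interval.c₀ = contacts J.left + contacts J.right := by
  rw [TamariInterval.c₀, J.split, contacts_add]

theorem c₀_leftComposition (J : PointedInterval) (I₂ : TamariInterval) :
    (J.leftComposition I₂).c₀ = J.index + I₂.c₀ := by
  simp only [TamariInterval.c₀, lower_leftComposition, contacts_nest, contacts_add, index]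
  omega

theorem distance_leftComposition (J : PointedInterval) (I₂ : TamariInterval) :
    (J.leftComposition I₂).distance = J.interval.distance + contacts J.right + I₂.distance := by
  apply le_antisymm
  · obtain ⟨p₁, p₂, n₁, n₂, hp, hn, h₁, h₂⟩ :=
      (J.leftComposition I₂).exists_rotationChain_distance.to_add
    obtain ⟨rfl, rfl⟩ := eq_of_add_eq_add_of_semilength (l := J.left.nest + J.right)
      (r := I₂.lower) hp (by rw [h₂.semilength_eq, I₂.semilength_eq])
    obtain ⟨l, r, n', hlr, h', hn'⟩ := h₁.to_nest
    obtain ⟨rfl, rfl⟩ := nest_add_inj.1 hlr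
    rw [← J.split] at h'
    have := h'.le_distance
    have := h₂.le_distance
    omega
  · have h₁ := J.interval.exists_rotationChain_distance
    rw [J.split] at h₁
    have h := ((RotationChain.nest_add J.left J.right).trans h₁.nest).add
      I₂.exists_rotationChain_distance
    have := RotationChain.le_distance (I := J.leftComposition I₂) h
    omega

theorem isSynchronized_leftComposition_iff (J : PointedInterval) (I₂ : TamariInterval) :
    (J.leftComposition I₂).IsSynchronized ↔
      (J.interval.c₀ = 0 ∨ J.index ≤ J.interval.c₀) ∧
        J.interval.IsSynchronized ∧ I₂.IsSynchronized := by
  have hJ := congrArg upType J.split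
  rw [upType_add] at hJ
  have hl := congrArg List.length hJ
  simp only [List.length_append, length_upType, J.interval.semilength_eq] at hl
  have h₀ : 0 < contacts J.interval.upper ↔ 0 < J.interval.c₀ := by
    have h := J.interval.semilength_eq
    rw [Nat.pos_iff_ne_zero, Nat.pos_iff_ne_zero, ne_eq, ne_eq, TamariInterval.c₀, contacts_eq_zero,
      contacts_eq_zero]
    refine not_congr ⟨fun h' => ?_, fun h' => ?_⟩ <;> by_contra hne <;>
      obtain ⟨a, b, hab⟩ := exists_nest_add_of_ne_zero hne <;> rw [h', hab] at h <;> simp at h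
    omega
  have hc := J.c₀_interval
  rw [TamariInterval.isSynchronized_iff, TamariInterval.isSynchronized_iff,
    TamariInterval.isSynchronized_iff, lower_leftComposition, upper_leftComposition,
    upType_nest_add, upType_nest_add, upType_add, ← List.append_assoc, ← hJ, List.cons.injEq,
    decide_eq_decide, h₀, index,
    (List.append_eq_append_iff_of_size_eq_left (by simp [length_upType, J.interval.semilength_eq]))]
  refine and_congr_left fun _ => ?_
  omega

/-- Left composition is injective. -/
theorem leftComposition_inj {J J' : PointedInterval} {I₂ I₂' : TamariInterval} :
    J.leftComposition I₂ = J'.leftComposition I₂' ↔ J = J' ∧ I₂ = I₂' := by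
  refine ⟨fun h => ?_, fun h => by rw [h.1, h.2]⟩
  have hu := congrArg TamariInterval.upper h
  have hl := congrArg TamariInterval.lower h
  rw [upper_leftComposition, upper_leftComposition, nest_add_inj] at hu
  rw [lower_leftComposition, lower_leftComposition, nest_add_inj] at hl
  obtain ⟨hr, h₂⟩ := eq_of_add_eq_add_of_semilength hl.2
    (by rw [I₂.semilength_eq, I₂'.semilength_eq, hu.2])
  refine ⟨?_, TamariInterval.ext h₂ hu.2⟩
  have hJ : J.interval = J'.interval :=
    TamariInterval.ext (by rw [J.split, J'.split, hl.1, hr]) hu.1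
  cases J
  cases J'
  simp_all

theorem ext_index {J J' : PointedInterval} (h : J.interval = J'.interval)
    (hi : J.index = J'.index) : J = J' := by
  have hlr := J.split
  rw [h, J'.split] at hlr
  obtain ⟨h₁, h₂⟩ := eq_of_add_eq_add_of_contacts hlr.symm (by simpa [index] using hi)
  cases J
  cases J'
  simp_all

theorem exists_index_eq (I : TamariInterval) {i : ℕ} (h₁ : 1 ≤ i) (h₂ : i ≤ I.c₀ + 1) :
    ∃ J : PointedInterval, J.interval = I ∧ J.index = i := by
  obtain ⟨l, r, hlr, hr⟩ := exists_add_contacts_eq I.lower (c := i - 1)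
    (by rw [TamariInterval.c₀] at h₂; omega)
  exact ⟨⟨I, l, r, hlr⟩, rfl, by rw [index, hr]; omega⟩

theorem index_le (J : PointedInterval) : J.index ≤ J.interval.c₀ + 1 := by
  rw [J.c₀_interval, index]
  omega

end PointedInterval

theorem TamariInterval.exists_eq_leftComposition {I : TamariInterval} (h : I ≠ empty) :
    ∃ J I₂, I = PointedInterval.leftComposition J I₂ := by
  have hu : I.upper ≠ 0 := by
    intro hu
    have hl := I.semilength_eq
    rw [hu] at hl
    refine h (TamariInterval.ext ?_ hu)
    by_contra hl'
    obtain ⟨a, b, hab⟩ := exists_nest_add_of_ne_zero hl'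
    rw [hab] at hl
    simp at hl
  obtain ⟨q₁, q₂, hq⟩ := exists_nest_add_of_ne_zero hu
  have hI := I.exists_rotationChain_distance
  rw [hq] at hI
  obtain ⟨p₁, p₂, _, _, hp, -, h₁, h₂⟩ := hI.to_add
  obtain ⟨l, r, _, rfl, h', -⟩ := h₁.to_nest
  exact ⟨⟨⟨l + r, q₁, h'.tamariLE⟩, l, r, rfl⟩, ⟨p₂, q₂, h₂.tamariLE⟩, TamariInterval.ext hp hq⟩

/-- Every Tamari interval is built from the empty one by left compositions. -/
theorem TamariInterval.composition_induction {motive : TamariInterval → Prop} (empty : motive empty)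
    (composition : ∀ (J : PointedInterval) (I₂ : TamariInterval), motive J.interval → motive I₂ →
      motive (J.leftComposition I₂)) (I : TamariInterval) : motive I := by
  induction hn : I.size using Nat.strong_induction_on generalizing I with
  | _ n ih =>
    by_cases h : I = TamariInterval.empty
    · rwa [h]
    · obtain ⟨J, I₂, rfl⟩ := exists_eq_leftComposition h
      rw [J.size_leftComposition] at hn
      exact composition J I₂ (ih _ (by omega) _ rfl) (ih _ (by omega) _ rfl)

/-! ### A grammar for the words of fish -/

/-- `Closes e l w`: the word `w` ends the tour of a fish that is waiting to go down along the strips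
of cells with lengths `l`, the current strip first, after `e` letters `E` that have just been read.
A letter `S` ends a strip of length `0`; a letter `W` runs along the upper side of one cell of the
current strip. A letter `N` opens a new strip above `i > 0` cells of the current one and above the
`e` pending letters `E`; the number `i` is guessed. A letter `V` stands for `WN`. -/
inductive Closes : ℕ → List ℕ → List FishStep → Prop
  | nil : Closes 0 [] []
  | south {l : List ℕ} {w : List FishStep} : Closes 0 l w → Closes 0 (0 :: l) (S :: w)
  | west {j : ℕ} {l : List ℕ} {w : List FishStep} :
      Closes 0 (j :: l) w → Closes 0 ((j + 1) :: l) (W :: w)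
  | vee {i j : ℕ} {l : List ℕ} {w : List FishStep} :
      0 < i → Closes 0 (i :: j :: l) w → Closes 0 ((i + j + 1) :: l) (V :: w)
  | east {e : ℕ} {l : List ℕ} {w : List FishStep} : Closes (e + 1) l w → Closes e l (E :: w)
  | north {e i j : ℕ} {l : List ℕ} {w : List FishStep} :
      0 < i → Closes 0 ((i + e) :: j :: l) w → Closes e ((i + j) :: l) (N :: w)

theorem closes_nil_iff {e : ℕ} {l : List ℕ} : Closes e l [] ↔ e = 0 ∧ l = [] := by
  refine ⟨fun h => ?_, fun h => by rw [h.1, h.2]; exact .nil⟩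
  cases h
  simp

theorem closes_south_iff {e : ℕ} {l : List ℕ} {w : List FishStep} :
    Closes e l (S :: w) ↔ e = 0 ∧ ∃ l', l = 0 :: l' ∧ Closes 0 l' w := by
  refine ⟨fun h => ?_, fun ⟨he, l', hl, h⟩ => by rw [he, hl]; exact h.south⟩
  cases h with
  | south h => exact ⟨rfl, _, rfl, h⟩

theorem closes_west_iff {e : ℕ} {l : List ℕ} {w : List FishStep} :
    Closes e l (W :: w) ↔ e = 0 ∧ ∃ j l', l = (j + 1) :: l' ∧ Closes 0 (j :: l') w := by
  refine ⟨fun h => ?_, fun ⟨he, j, l', hl, h⟩ => by rw [he, hl]; exact h.west⟩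
  cases h with
  | west h => exact ⟨rfl, _, _, rfl, h⟩

theorem closes_vee_iff {e : ℕ} {l : List ℕ} {w : List FishStep} :
    Closes e l (V :: w) ↔
      e = 0 ∧ ∃ i j l', 0 < i ∧ l = (i + j + 1) :: l' ∧ Closes 0 (i :: j :: l') w := by
  refine ⟨fun h => ?_, fun ⟨he, i, j, l', hi, hl, h⟩ => by rw [he, hl]; exact .vee hi h⟩
  cases h with
  | vee hi h => exact ⟨rfl, _, _, _, hi, rfl, h⟩

theorem closes_east_iff {e : ℕ} {l : List ℕ} {w : List FishStep} :
    Closes e l (E :: w) ↔ Closes (e + 1) l w := by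
  refine ⟨fun h => ?_, .east⟩
  cases h with
  | east h => exact h

theorem closes_north_iff {e : ℕ} {l : List ℕ} {w : List FishStep} :
    Closes e l (N :: w) ↔
      ∃ i j l', 0 < i ∧ l = (i + j) :: l' ∧ Closes 0 ((i + e) :: j :: l') w := by
  refine ⟨fun h => ?_, fun ⟨i, j, l', hi, hl, h⟩ => by rw [hl]; exact .north hi h⟩
  cases h with
  | north hi h => exact ⟨_, _, _, hi, rfl, h⟩

namespace Closes

theorem append_congr {w w' : List FishStep} (hw : ∀ e l, Closes e l w → Closes e l w')
    (a : List FishStep) {e : ℕ} {l : List ℕ} (h : Closes e l (a ++ w)) :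
    Closes e l (a ++ w') := by
  induction a generalizing e l with
  | nil => exact hw e l h
  | cons x a ih =>
    cases x with
    | E => exact closes_east_iff.2 (ih (closes_east_iff.1 h))
    | N =>
      obtain ⟨i, j, l', hi, hl, h⟩ := closes_north_iff.1 h
      exact closes_north_iff.2 ⟨i, j, l', hi, hl, ih h⟩
    | W =>
      obtain ⟨he, j, l', hl, h⟩ := closes_west_iff.1 h
      exact closes_west_iff.2 ⟨he, j, l', hl, ih h⟩
    | S =>
      obtain ⟨he, l', hl, h⟩ := closes_south_iff.1 h
      exact closes_south_iff.2 ⟨he, l', hl, ih h⟩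
    | V =>
      obtain ⟨he, i, j, l', hi, hl, h⟩ := closes_vee_iff.1 h
      exact closes_vee_iff.2 ⟨he, i, j, l', hi, hl, ih h⟩

theorem upper {e : ℕ} {l : List ℕ} {b : List FishStep} (h : Closes e l (W :: b)) :
    Closes e l (N :: W :: S :: b) := by
  obtain ⟨rfl, j, l', rfl, h'⟩ := closes_west_iff.1 h
  rw [add_comm]
  exact .north one_pos (.west (.south h'))

theorem lower {e : ℕ} {l : List ℕ} {b : List FishStep} (h : Closes e l (N :: b)) :
    Closes e l (E :: N :: W :: b) := by
  obtain ⟨i, j, l', hi, rfl, h'⟩ := closes_north_iff.1 h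
  exact .east (.north hi (.west h'))

/-- Gluing a cell to a factor `WN` lengthens the part of the current strip that lies under the strip
opened by `N`. -/
theorem double {e : ℕ} {l : List ℕ} {b : List FishStep} (h : Closes e l (W :: N :: b)) :
    Closes e l (N :: W :: b) := by
  obtain ⟨rfl, j, l', rfl, h₁⟩ := closes_west_iff.1 h
  obtain ⟨i, j, l', hi, hl, h'⟩ := closes_north_iff.1 h₁
  obtain ⟨rfl, rfl⟩ := List.cons.inj hl
  rw [add_right_comm]
  exact .north (Nat.succ_pos i) (.west h')

theorem append {e : ℕ} {l l' : List ℕ} {w w' : List FishStep} (h : Closes e l w)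
    (h' : Closes 0 l' w') : Closes e (l ++ l') (w ++ w') := by
  induction h with
  | nil => exact h'
  | south _ ih => exact south ih
  | west _ ih => exact west ih
  | vee hi _ ih => exact vee hi ih
  | east _ ih => exact east ih
  | north hi _ ih => exact north hi ih

theorem exists_append {e : ℕ} {l l' : List ℕ} {w : List FishStep} (h : Closes e (l ++ l') w)
    (hl : l = [] → e = 0) : ∃ w₁ w₂, w = w₁ ++ w₂ ∧ Closes e l w₁ ∧ Closes 0 l' w₂ := by
  generalize hL : l ++ l' = L at h
  induction h generalizing l with
  | nil =>
    obtain ⟨rfl, rfl⟩ := List.append_eq_nil_iff.1 hL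
    exact ⟨[], [], rfl, .nil, .nil⟩
  | @south m w h ih =>
    rcases List.append_eq_cons_iff.1 hL with ⟨rfl, rfl⟩ | ⟨m', rfl, rfl⟩
    · exact ⟨[], _, rfl, .nil, h.south⟩
    · obtain ⟨w₁, w₂, rfl, h₁, h₂⟩ := ih (by simp) rfl
      exact ⟨_, _, rfl, h₁.south, h₂⟩
  | @west j m w h ih =>
    rcases List.append_eq_cons_iff.1 hL with ⟨rfl, rfl⟩ | ⟨m', rfl, rfl⟩
    · exact ⟨[], _, rfl, .nil, h.west⟩
    · obtain ⟨w₁, w₂, rfl, h₁, h₂⟩ := ih (l := j :: m') (by simp) rfl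
      exact ⟨_, _, rfl, h₁.west, h₂⟩
  | @vee i j m w hi h ih =>
    rcases List.append_eq_cons_iff.1 hL with ⟨rfl, rfl⟩ | ⟨m', rfl, rfl⟩
    · exact ⟨[], _, rfl, .nil, h.vee hi⟩
    · obtain ⟨w₁, w₂, rfl, h₁, h₂⟩ := ih (l := i :: j :: m') (by simp) rfl
      exact ⟨_, _, rfl, h₁.vee hi, h₂⟩
  | @east e m w h ih =>
    by_cases hl' : l = []
    · subst hl'
      obtain rfl := hl rfl
      subst hL
      exact ⟨[], _, rfl, .nil, h.east⟩
    · obtain ⟨w₁, w₂, rfl, h₁, h₂⟩ := ih (fun h => absurd h hl') hL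
      exact ⟨_, _, rfl, h₁.east, h₂⟩
  | @north e i j m w hi h ih =>
    rcases List.append_eq_cons_iff.1 hL with ⟨rfl, rfl⟩ | ⟨m', rfl, rfl⟩
    · obtain rfl := hl rfl
      exact ⟨[], _, rfl, .nil, h.north hi⟩
    · obtain ⟨w₁, w₂, rfl, h₁, h₂⟩ := ih (l := (i + e) :: j :: m') (by simp) rfl
      exact ⟨_, _, rfl, h₁.north hi, h₂⟩

theorem sum_eq {e : ℕ} {l : List ℕ} {w : List FishStep} (h : Closes e l w) :
    w.count W + w.count V = l.sum + e + w.count E := by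
  induction h with
  | nil => rfl
  | _ => simp_all; try omega

theorem eq_nil {e : ℕ} {w : List FishStep} (h : Closes e [] w) : w = [] := by
  generalize hl : ([] : List ℕ) = l at h
  induction h with
  | nil => rfl
  | @east e l w h ih =>
    obtain rfl := ih hl
    have := (closes_nil_iff.1 h).1
    omega
  | _ => simp at hl

/-- The words that close a given number of strips form a prefix code. -/
theorem append_inj {e e' : ℕ} {l l' : List ℕ} {w w' x x' : List FishStep} (h : Closes e l w)
    (h' : Closes e' l' w') (hl : l.length = l'.length) (hw : w ++ x = w' ++ x') :
    w = w' ∧ x = x' := by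
  suffices w = w' by subst this; exact ⟨rfl, List.append_cancel_left hw⟩
  have key : l = [] → w = w' := by
    rintro rfl
    obtain rfl := List.length_eq_zero_iff.1 hl.symm
    rw [h.eq_nil, h'.eq_nil]
  induction h generalizing w' e' l' with
  | nil => exact key rfl
  | south h ih =>
    cases h' with
    | south h' => rw [ih h' (by simpa using hl) (by simpa using hw) (by
        rintro rfl
        obtain rfl := List.length_eq_zero_iff.1 (show _ = 0 by simpa using hl.symm)
        rw [h.eq_nil, h'.eq_nil])]
    | nil => simp at hl
    | _ => simp at hw
  | west h ih =>
    cases h' with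
    | west h' => rw [ih h' (by simpa using hl) (by simpa using hw) (by simp)]
    | nil => simp at hl
    | _ => simp at hw
  | vee _ h ih =>
    cases h' with
    | vee _ h' => rw [ih h' (by simpa using hl) (by simpa using hw) (by simp)]
    | nil => simp at hl
    | _ => simp at hw
  | north _ h ih =>
    cases h' with
    | north _ h' => rw [ih h' (by simpa using hl) (by simpa using hw) (by simp)]
    | nil => simp at hl
    | _ => simp at hw
  | @east e l w h ih =>
    cases h' with
    | east h' => rw [ih h' (by simpa using hl) (by simpa using hw) (by
        rintro rfl
        obtain rfl := List.length_eq_zero_iff.1 hl.symm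
        rw [h.eq_nil, h'.eq_nil])]
    | nil =>
      obtain rfl := List.length_eq_zero_iff.1 hl
      exact key rfl
    | _ => simp at hw

end Closes

theorem unmark_nil : unmark [] = [] := rfl

theorem unmark_cons (x : FishStep) (w : List FishStep) :
    unmark (x :: w) = (if x = V then [W, N] else [x]) ++ unmark w := rfl

theorem unmark_append (v w : List FishStep) : unmark (v ++ w) = unmark v ++ unmark w :=
  List.flatMap_append

theorem unmark_eq_self {w : List FishStep} (h : V ∉ w) : unmark w = w := by
  induction w with
  | nil => rfl
  | cons x w ih =>
    simp only [List.mem_cons, not_or] at h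
    rw [unmark_cons, if_neg (Ne.symm h.1), ih h.2, List.singleton_append]

theorem unmark_replicate (j : ℕ) : unmark (List.replicate j E) = List.replicate j E :=
  unmark_eq_self (by simp [List.mem_replicate])

theorem closes_unmark_iff {e : ℕ} {l : List ℕ} {w : List FishStep} :
    Closes e l (unmark w) ↔ Closes e l w := by
  induction w generalizing e l with
  | nil => rfl
  | cons x w ih =>
    cases x with
    | V =>
      simp only [unmark_cons, if_true, List.cons_append, List.nil_append, closes_west_iff,
        closes_north_iff, closes_vee_iff, ih]
      refine and_congr_right fun _ => ⟨?_, ?_⟩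
      · rintro ⟨j, l, rfl, i, j, l, hi, hl, h⟩
        obtain ⟨rfl, rfl⟩ := List.cons.inj hl
        exact ⟨i, j, _, hi, rfl, h⟩
      · rintro ⟨i, j, l, hi, rfl, h⟩
        exact ⟨_, _, rfl, i, j, l, hi, rfl, h⟩
    | _ =>
      simp [unmark_cons, closes_west_iff, closes_north_iff, closes_south_iff, closes_east_iff, ih]

/-! ### Fish satisfy the grammar -/

/-- `Opens e w`: after `e` letters `E`, the word `w` consists of a possibly empty run of letters
`E`, a letter `N`, and a word that closes the strip above the letters `E`. -/
inductive Opens : ℕ → List FishStep → Prop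
  | east {e : ℕ} {w : List FishStep} : Opens (e + 1) w → Opens e (E :: w)
  | north {e : ℕ} {w : List FishStep} : 0 < e → Closes 0 [e] w → Opens e (N :: w)

theorem Opens.append_congr {w w' : List FishStep} (hc : ∀ e l, Closes e l w → Closes e l w')
    (ho : ∀ e, Opens e w → Opens e w') (a : List FishStep) {e : ℕ} (h : Opens e (a ++ w)) :
    Opens e (a ++ w') := by
  induction a generalizing e with
  | nil => exact ho e h
  | cons x a ih =>
    cases h with
    | east h => exact .east (ih h)
    | north he h => exact .north he (h.append_congr hc)

theorem Opens.exists_eq {e : ℕ} {w : List FishStep} (h : Opens e w) :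
    ∃ m w', w = List.replicate m E ++ N :: w' ∧ 0 < e + m ∧ Closes 0 [e + m] w' := by
  induction h with
  | @east e w _ ih =>
    obtain ⟨m, w', rfl, hm, h⟩ := ih
    rw [add_assoc, add_comm 1] at hm h
    exact ⟨m + 1, w', rfl, hm, h⟩
  | @north e w he h => exact ⟨0, w, rfl, he, h⟩

theorem Built.opens {k : ℕ} {w : List FishStep} (h : Built k w) : Opens 0 w := by
  induction h with
  | head => exact .east (.north one_pos (.west (.south .nil)))
  | upper a b _ ih =>
    simp only [List.append_assoc, List.cons_append, List.nil_append] at ih ⊢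
    exact ih.append_congr (fun _ _ h => h.upper) (fun e h => nomatch h) a
  | lower a b _ ih =>
    simp only [List.append_assoc, List.cons_append, List.nil_append] at ih ⊢
    refine ih.append_congr (fun _ _ h => h.lower) (fun e h => ?_) a
    cases h with
    | north he h => exact .east (.north (Nat.succ_pos e) h.west)
  | double a b _ ih =>
    simp only [List.append_assoc, List.cons_append, List.nil_append] at ih ⊢
    exact ih.append_congr (fun _ _ h => h.double) (fun e h => nomatch h) a

theorem Built.not_mem_V {k : ℕ} {w : List FishStep} (h : Built k w) : V ∉ w := by
  induction h with
  | head => simp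
  | _ => simp_all

/-! ### Fish are closed under augmentation and concatenation -/

/-- A row of `i > 0` cells can be glued under the first `i` lower edges of a fish. -/
theorem Built.augment {k i : ℕ} {w : List FishStep} (hi : 0 < i)
    (h : Built k (List.replicate i E ++ w)) :
    Built (k + i) (List.replicate i E ++ N :: (w ++ [S])) := by
  generalize hv : List.replicate i E ++ w = v at h
  -- the cell is glued after the first `i` letters, or to the edge `N` that ends the jaw
  have split {i : ℕ} {w a b y : List FishStep} (h : List.replicate i E ++ w = a ++ y ++ b) :
      (∃ c, a = List.replicate i E ++ c ∧ w = c ++ y ++ b) ∨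
        ∃ c, List.replicate i E = a ++ E :: c ∧ y ++ b = E :: (c ++ w) := by
    rw [List.append_assoc] at h
    rcases List.append_eq_append_iff.1 h with ⟨c, ha, hw⟩ | ⟨c, ha, hw⟩
    · exact Or.inl ⟨c, ha, by simpa using hw⟩
    · cases c with
      | nil => exact Or.inl ⟨[], by simpa using ha.symm, by simpa using hw.symm⟩
      | cons x c =>
        obtain rfl : x = E := (List.eq_replicate_iff.1 ha.symm).2 x (by simp)
        exact Or.inr ⟨c, ha, hw⟩
  have glue {k i : ℕ} {w a b x y : List FishStep}
      (step : ∀ a b, Built (k + i) (a ++ x ++ b) → Built (k + i + 1) (a ++ y ++ b))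
      (ih : ∀ {w}, List.replicate i E ++ w = a ++ x ++ b →
        Built (k + i) (List.replicate i E ++ N :: (w ++ [S])))
      (h : ∃ c, a = List.replicate i E ++ c ∧ w = c ++ y ++ b) :
      Built (k + 1 + i) (List.replicate i E ++ N :: (w ++ [S])) := by
    obtain ⟨c, ha, rfl⟩ := h
    have h := ih (w := c ++ x ++ b) (by simp [ha])
    rw [add_right_comm]
    simpa using step (List.replicate i E ++ N :: c) (b ++ [S]) (by simpa using h)
  induction h generalizing i w with
  | head =>
    match i, hi with
    | 1, _ =>
      obtain rfl : w = [N, W, S] := by simpa using hv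
      exact Built.upper [E, N] [S] Built.head
    | i + 2, _ => simp [List.replicate_succ] at hv
  | upper a b _ ih =>
    rcases split hv with h | ⟨c, -, h⟩
    · exact glue (fun a b => Built.upper a b) (ih hi) h
    · simp at h
  | double a b _ ih =>
    rcases split hv with h | ⟨c, -, h⟩
    · exact glue (fun a b => Built.double a b) (ih hi) h
    · simp at h
  | @lower k a b h ih =>
    rcases split hv with h | ⟨c, ha, hw⟩
    · exact glue (fun a b => Built.lower a b) (ih hi) h
    · cases c with
      | cons x c =>
        obtain rfl : x = E := (List.eq_replicate_iff.1 ha.symm).2 x (by simp)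
        simp at hw
      | nil =>
        simp only [List.cons_append, List.nil_append, List.cons.injEq, true_and] at hw
        subst hw
        have ha' := List.eq_replicate_iff.1 ha.symm
        obtain ⟨m, rfl⟩ : ∃ m, i = m + 1 := ⟨i - 1, by omega⟩
        obtain rfl : a = List.replicate m E := List.eq_replicate_iff.2
          ⟨by simpa using ha'.1, fun x hx => ha'.2 x (by simp [hx])⟩
        rcases Nat.eq_zero_or_pos m with rfl | hm
        · cases h.opens with
          | north h₀ _ => exact absurd h₀ (lt_irrefl 0)
        · -- the new row gets its last cell first, and the jaw of the fish above it follows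
          have h₁ := Built.lower (List.replicate m E) (N :: (b ++ [S]))
            (by simpa using ih (w := N :: b) hm (by simp))
          have h₂ := Built.double (List.replicate m E ++ [E, N]) (b ++ [S]) (by simpa using h₁)
          simpa [add_assoc, add_comm, add_left_comm, List.replicate_succ'] using h₂

/-- Replacing an edge `N` of a fish by a fish `G S` without its last edge amounts to gluing the two
fish along these edges. -/
theorem Built.exists_concat {k : ℕ} {w : List FishStep} (h : Built k w) :
    ∃ g, w = g ++ [S] ∧ ∀ {k' : ℕ} {a b : List FishStep}, Built k' (a ++ N :: b) →
      Built (k' + k) (a ++ g ++ b) := by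
  have last {c d g : List FishStep} {x : FishStep} (hx : x ≠ S)
      (h : c ++ x :: d = g ++ [S]) : ∃ d', d = d' ++ [S] ∧ g = c ++ x :: d' := by
    rcases List.eq_nil_or_concat d with rfl | ⟨d', y, rfl⟩
    · exact absurd (List.append_inj' h rfl).2 (by simpa using hx)
    · have h' : (c ++ x :: d') ++ [y] = g ++ [S] := by simpa using h
      obtain ⟨h₁, h₂⟩ := List.append_inj' h' rfl
      obtain rfl : y = S := by simpa using h₂
      exact ⟨d', by simp, h₁.symm⟩
  induction h with
  | head => exact ⟨[E, N, W], rfl, fun {k' a b} h => by simpa using Built.lower a b (by simpa)⟩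
  | @upper k a b _ ih =>
    obtain ⟨g, hg, ih⟩ := ih
    obtain ⟨d, rfl, rfl⟩ := last (c := a) (d := b) (x := W) (by simp) (by simpa using hg)
    refine ⟨a ++ [N, W, S] ++ d, by simp, fun {k' c f} h => ?_⟩
    rw [← add_assoc]
    simpa using Built.upper (c ++ a) (d ++ f) (by simpa using ih h)
  | @lower k a b _ ih =>
    obtain ⟨g, hg, ih⟩ := ih
    obtain ⟨d, rfl, rfl⟩ := last (c := a) (d := b) (x := N) (by simp) (by simpa using hg)
    refine ⟨a ++ [E, N, W] ++ d, by simp, fun {k' c f} h => ?_⟩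
    rw [← add_assoc]
    simpa using Built.lower (c ++ a) (d ++ f) (by simpa using ih h)
  | @double k a b _ ih =>
    obtain ⟨g, hg, ih⟩ := ih
    obtain ⟨d, rfl, rfl⟩ := last (c := a ++ [W]) (d := b) (x := N) (by simp) (by simpa using hg)
    refine ⟨a ++ [N, W] ++ d, by simp, fun {k' c f} h => ?_⟩
    rw [← add_assoc]
    simpa using Built.double (c ++ a) (d ++ f) (by simpa using ih h)

theorem Built.concat {k k' : ℕ} {a b g : List FishStep} (h : Built k (g ++ [S]))
    (h' : Built k' (a ++ N :: b)) : Built (k' + k) (a ++ g ++ b) := by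
  obtain ⟨g', hg, H⟩ := h.exists_concat
  obtain rfl := List.append_cancel_right hg
  exact H h'

/-! ### Area -/

/-- The contribution of the steps `w` to the shoelace formula, from a point with longitude `x`. -/
def areaFrom : ℤ → List FishStep → ℤ
  | _, [] => 0
  | x, s :: w => lat [s] * (x + long [s]) + areaFrom (x + long [s]) w

theorem lat_append (v w : List FishStep) : lat (v ++ w) = lat v + lat w := by
  simp [lat]
  ring

theorem long_append (v w : List FishStep) : long (v ++ w) = long v + long w := by
  simp [long]
  ring

theorem sum_eq_areaFrom (x : ℤ) (w : List FishStep) :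
    ∑ i ∈ Finset.range w.length,
      (lat (w.take (i + 1)) - lat (w.take i)) * (x + long (w.take (i + 1))) = areaFrom x w := by
  induction w generalizing x with
  | nil => rfl
  | cons s w ih =>
    have hlat (i : ℕ) : lat ((s :: w).take (i + 1)) = lat [s] + lat (w.take i) :=
      lat_append [s] (w.take i)
    have hlong (i : ℕ) : long ((s :: w).take (i + 1)) = long [s] + long (w.take i) :=
      long_append [s] (w.take i)
    rw [List.length_cons, Finset.sum_range_succ', areaFrom, ← ih, add_comm]
    congr 1
    · rw [hlat, hlong]
      simp [lat, long]
    · refine Finset.sum_congr rfl fun i _ => ?_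
      rw [hlat, hlat, hlong]
      ring

theorem area_eq_areaFrom (w : List FishStep) : area w = areaFrom 0 w := by
  simp [area, ← sum_eq_areaFrom]

theorem areaFrom_append (x : ℤ) (v w : List FishStep) :
    areaFrom x (v ++ w) = areaFrom x v + areaFrom (x + long v) w := by
  induction v generalizing x with
  | nil => simp [areaFrom, long]
  | cons s v ih =>
    have h : long (s :: v) = long [s] + long v := long_append [s] v
    rw [List.cons_append, areaFrom, areaFrom, ih, h]
    ring_nf

theorem Built.area_eq {k : ℕ} {w : List FishStep} (h : Built k w) : area w = k := by
  rw [area_eq_areaFrom]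
  induction h with
  | head => simp [areaFrom, lat, long]
  | _ a b _ ih =>
    simp only [areaFrom_append, long_append] at ih ⊢
    simp [areaFrom, lat, long] at ih ⊢
    linarith

theorem area_unmark (w : List FishStep) : area (unmark w) = area w := by
  rw [area_eq_areaFrom, area_eq_areaFrom]
  generalize (0 : ℤ) = x
  induction w generalizing x with
  | nil => rfl
  | cons s w ih =>
    rw [unmark_cons, areaFrom_append]
    cases s <;> simp [areaFrom, lat, long, ih]

/-! ### Composition of fish -/

/-- The word of the fish with jaw length `j` whose remaining steps, after the letter `N` that ends
the jaw, are `w`; the empty fish has jaw length `0`. -/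
def fishWord (j : ℕ) (w : List FishStep) : List FishStep :=
  if j = 0 then emptyWord else List.replicate j E ++ N :: w

/-- The steps after the jaw in the low composition, at index `i`, of two fish with steps `w₁` and
`w₂` after their jaws, where `j₁` is the jaw length of the first. -/
def lowTail (i j₁ : ℕ) (w₁ w₂ : List FishStep) : List FishStep :=
  if j₁ = 0 then W :: w₂
  else if i ≤ j₁ then List.replicate (j₁ - i) E ++ N :: (w₁ ++ w₂)
  else V :: (w₁ ++ w₂)

theorem closes_zero_iff {w : List FishStep} : Closes 0 [0] w ↔ w = [S] := by
  refine ⟨fun h => ?_, fun h => by rw [h]; exact .south .nil⟩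
  have key {e : ℕ} {w : List FishStep} (h : Closes e [0] w) : ∃ m, w = List.replicate m E ++ [S] := by
    generalize hl : [0] = l at h
    induction h with
    | south h =>
      obtain rfl := (List.cons.inj hl).2
      exact ⟨0, by rw [h.eq_nil]; rfl⟩
    | east h ih =>
      obtain ⟨m, rfl⟩ := ih hl
      exact ⟨m + 1, rfl⟩
    | nil => simp at hl
    | west h => simp at hl
    | vee hi h => simp at hl
    | north hi h =>
      have := (List.cons.inj hl).1
      omega
  obtain ⟨m, rfl⟩ := key h
  have := h.sum_eq
  simp [List.count_replicate] at this
  simp [this]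

theorem closes_replicate_iff {e m : ℕ} {l : List ℕ} {w : List FishStep} :
    Closes e l (List.replicate m E ++ w) ↔ Closes (e + m) l w := by
  induction m generalizing e with
  | zero => simp
  | succ m ih =>
    rw [List.replicate_succ, List.cons_append, closes_east_iff, ih, add_right_comm, add_assoc]

/-- The grammar is closed under low compositions. -/
theorem closes_lowTail {i j₁ j₂ : ℕ} {w₁ w₂ : List FishStep} (hi : 0 < i) (hij : i ≤ j₁ + 1)
    (h₁ : Closes 0 [j₁] w₁) (h₂ : Closes 0 [j₂] w₂) :
    Closes 0 [i + j₂] (lowTail i j₁ w₁ w₂) := by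
  have h := h₁.append h₂
  unfold lowTail
  split_ifs with hj hle
  · obtain rfl : i = 1 := by omega
    rw [add_comm]
    exact h₂.west
  · rw [closes_replicate_iff]
    refine .north hi ?_
    rwa [show i + (0 + (j₁ - i)) = j₁ by omega]
  · rw [show i + j₂ = j₁ + j₂ + 1 by omega]
    exact .vee (by omega) h

/-- Every word that closes a single strip, other than `S`, is that of a low composition: if it starts
with `W`, the first fish is empty; otherwise the first fish ends where the first strip that is
opened gets closed. -/
theorem Closes.exists_eq_lowTail {j : ℕ} {w : List FishStep} (h : Closes 0 [j] w) :
    (j = 0 ∧ w = [S]) ∨ ∃ i j₁ j₂ w₁ w₂, 0 < i ∧ i ≤ j₁ + 1 ∧ Closes 0 [j₁] w₁ ∧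
      Closes 0 [j₂] w₂ ∧ j = i + j₂ ∧ w = lowTail i j₁ w₁ w₂ := by
  have north {e : ℕ} {w : List FishStep} (h : Closes e [j] w)
      (hw : 0 < e ∨ ∃ x w', w = x :: w' ∧ (x = E ∨ x = N)) :
      ∃ a i j₂ w', w = List.replicate a E ++ N :: w' ∧ 0 < i ∧ j = i + j₂ ∧
        Closes 0 [i + (e + a), j₂] w' := by
    induction w generalizing e with
    | nil => simp [closes_nil_iff] at h
    | cons x w ih =>
      cases x with
      | E =>
        obtain ⟨a, i, j₂, w', rfl, hi, hj, h'⟩ := ih (closes_east_iff.1 h) (Or.inl e.succ_pos)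
        rw [add_assoc, add_comm 1] at h'
        exact ⟨a + 1, i, j₂, w', rfl, hi, hj, h'⟩
      | N =>
        obtain ⟨i, j₂, l, hi, hj, h'⟩ := closes_north_iff.1 h
        obtain ⟨rfl, rfl⟩ := List.cons.inj hj
        exact ⟨0, i, j₂, w, rfl, hi, rfl, h'⟩
      | W =>
        have := (closes_west_iff.1 h).1
        simp at hw
        omega
      | S =>
        have := (closes_south_iff.1 h).1
        simp at hw
        omega
      | V =>
        have := (closes_vee_iff.1 h).1
        simp at hw
        omega
  have north' (hw : ∃ x w', w = x :: w' ∧ (x = E ∨ x = N)) :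
      ∃ i j₁ j₂ w₁ w₂, 0 < i ∧ i ≤ j₁ + 1 ∧ Closes 0 [j₁] w₁ ∧
        Closes 0 [j₂] w₂ ∧ j = i + j₂ ∧ w = lowTail i j₁ w₁ w₂ := by
    obtain ⟨a, i, j₂, w', rfl, hi, hj, h'⟩ := north h (Or.inr hw)
    obtain ⟨w₁, w₂, rfl, h₁, h₂⟩ := h'.exists_append (l := [i + (0 + a)]) (by simp)
    refine ⟨i, i + (0 + a), j₂, w₁, w₂, hi, by omega, h₁, h₂, hj, ?_⟩
    rw [lowTail, if_neg (by omega), if_pos (by omega), show i + (0 + a) - i = a by omega]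
  cases w with
  | nil => simp [closes_nil_iff] at h
  | cons x w =>
    cases x with
    | E => exact Or.inr (north' ⟨E, w, rfl, Or.inl rfl⟩)
    | N => exact Or.inr (north' ⟨N, w, rfl, Or.inr rfl⟩)
    | S =>
      obtain ⟨-, l, hl, h⟩ := closes_south_iff.1 h
      obtain ⟨rfl, rfl⟩ := List.cons.inj hl
      exact Or.inl ⟨rfl, by rw [h.eq_nil]⟩
    | W =>
      obtain ⟨-, j', l, hl, h⟩ := closes_west_iff.1 h
      obtain ⟨rfl, rfl⟩ := List.cons.inj hl
      exact Or.inr ⟨1, 0, j', [S], w, one_pos, le_rfl, .south .nil, h, add_comm _ _, by simp [lowTail]⟩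
    | V =>
      obtain ⟨-, i, j', l, hi, hl, h⟩ := closes_vee_iff.1 h
      obtain ⟨rfl, rfl⟩ := List.cons.inj hl
      obtain ⟨w₁, w₂, rfl, h₁, h₂⟩ := h.exists_append (l := [i]) (by simp)
      exact Or.inr ⟨i + 1, i, j', w₁, w₂, by omega, le_rfl, h₁, h₂, by omega,
        by rw [lowTail, if_neg (by omega), if_neg (by omega)]⟩

theorem replicate_append_north_inj {a b : ℕ} {v w : List FishStep}
    (h : List.replicate a E ++ N :: v = List.replicate b E ++ N :: w) : a = b ∧ v = w := by
  induction a generalizing b with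
  | zero =>
    cases b with
    | zero => exact ⟨rfl, by simpa using h⟩
    | succ b => simp [List.replicate_succ] at h
  | succ a ih =>
    cases b with
    | zero => simp [List.replicate_succ] at h
    | succ b =>
      obtain ⟨rfl, hw⟩ := ih (by simpa [List.replicate_succ] using h)
      exact ⟨rfl, hw⟩

/-- Low composition is injective: the two factors are separated because closing words form a prefix
code, and the jaw lengths follow by counting the steps `E`, `W` and `V`. -/
theorem lowTail_inj {i j₁ j₂ i' j₁' j₂' : ℕ} {w₁ w₂ w₁' w₂' : List FishStep}
    (hi : 0 < i) (hij : i ≤ j₁ + 1) (h₁ : Closes 0 [j₁] w₁) (h₂ : Closes 0 [j₂] w₂)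
    (hi' : 0 < i') (hij' : i' ≤ j₁' + 1) (h₁' : Closes 0 [j₁'] w₁') (h₂' : Closes 0 [j₂'] w₂')
    (h : lowTail i j₁ w₁ w₂ = lowTail i' j₁' w₁' w₂') :
    i = i' ∧ j₁ = j₁' ∧ j₂ = j₂' ∧ w₁ = w₁' ∧ w₂ = w₂' := by
  -- the steps after the jaw determine its length, since the tour is closed
  have jaw_eq {j j' : ℕ} {w : List FishStep} (h : Closes 0 [j] w) (h' : Closes 0 [j'] w) :
      j = j' := by
    have := h.sum_eq
    have := h'.sum_eq
    simp at *
    omega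
  have main (h : w₁ ++ w₂ = w₁' ++ w₂') : j₁ = j₁' ∧ j₂ = j₂' ∧ w₁ = w₁' ∧ w₂ = w₂' := by
    obtain ⟨rfl, rfl⟩ := h₁.append_inj h₁' rfl h
    exact ⟨jaw_eq h₁ h₁', jaw_eq h₂ h₂', rfl, rfl⟩
  have head (a : ℕ) (x : List FishStep) : ∃ y z, List.replicate a E ++ N :: x = y :: z ∧
      y ≠ W ∧ y ≠ V := by
    cases a with
    | zero => exact ⟨N, x, rfl, by simp, by simp⟩
    | succ a => exact ⟨E, _, rfl, by simp, by simp⟩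
  unfold lowTail at h
  split_ifs at h with hj hj' _ hj' hle hle' hle' hj'
  · subst hj hj'
    obtain rfl := (List.cons.inj h).2
    rw [closes_zero_iff] at h₁ h₁'
    exact ⟨by omega, rfl, jaw_eq h₂ h₂', by rw [h₁, h₁'], rfl⟩
  · obtain ⟨y, z, hyz, hy, -⟩ := head (j₁' - i') (w₁' ++ w₂')
    rw [hyz] at h
    exact absurd (List.cons.inj h).1.symm hy
  · simp at h
  · obtain ⟨y, z, hyz, hy, -⟩ := head (j₁ - i) (w₁ ++ w₂)
    rw [hyz] at h
    exact absurd (List.cons.inj h).1 hy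
  · obtain ⟨ha, hw⟩ := replicate_append_north_inj h
    obtain ⟨rfl, h'⟩ := main hw
    exact ⟨by omega, rfl, h'⟩
  · obtain ⟨y, z, hyz, -, hy⟩ := head (j₁ - i) (w₁ ++ w₂)
    rw [hyz] at h
    exact absurd (List.cons.inj h).1 hy
  · simp at h
  · obtain ⟨y, z, hyz, -, hy⟩ := head (j₁' - i') (w₁' ++ w₂')
    rw [hyz] at h
    exact absurd (List.cons.inj h).1.symm hy
  · obtain ⟨rfl, h'⟩ := main (List.cons.inj h).2
    exact ⟨by omega, rfl, h'⟩

theorem fishWord_of_pos {j : ℕ} (hj : 0 < j) (w : List FishStep) :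
    fishWord j w = List.replicate j E ++ N :: w := if_neg hj.ne'

theorem replicate_append_north_ne_emptyWord (j : ℕ) (w : List FishStep) :
    List.replicate j E ++ N :: w ≠ emptyWord := by
  match j with
  | 0 => simp [emptyWord]
  | 1 => simp [emptyWord]
  | j + 2 => simp [emptyWord, List.replicate_succ]

theorem jaw_replicate_append_north (j : ℕ) (w : List FishStep) :
    jaw (List.replicate j E ++ N :: w) = j := by
  rw [jaw, if_neg (replicate_append_north_ne_emptyWord j w), List.takeWhile_append_of_pos]
  · simp
  · simp [List.mem_replicate]

theorem jaw_fishWord (j : ℕ) (w : List FishStep) : jaw (fishWord j w) = j := by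
  rcases Nat.eq_zero_or_pos j with rfl | hj
  · simp [fishWord, jaw]
  · rw [fishWord_of_pos hj, jaw_replicate_append_north]

theorem fishWord_inj {j j' : ℕ} {w w' : List FishStep} (h : Closes 0 [j] w) (h' : Closes 0 [j'] w')
    (hw : fishWord j w = fishWord j' w') : j = j' ∧ w = w' := by
  have hj := congrArg jaw hw
  rw [jaw_fishWord, jaw_fishWord] at hj
  subst hj
  refine ⟨rfl, ?_⟩
  rcases Nat.eq_zero_or_pos j with rfl | hj
  · rw [closes_zero_iff.1 h, closes_zero_iff.1 h']
  · rw [fishWord_of_pos hj, fishWord_of_pos hj] at hw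
    exact (replicate_append_north_inj hw).2

theorem drop_jaw (j : ℕ) (w : List FishStep) :
    (List.replicate j E ++ N :: w).drop (j + 1) = w := by
  induction j with
  | zero => rfl
  | succ j ih => simpa [List.replicate_succ] using ih

theorem fishAugment_fishWord {i j : ℕ} {w : List FishStep} (hi : 0 < i) (hij : i ≤ j + 1) :
    fishAugment i (fishWord j w) = List.replicate i E ++ N :: lowTail i j w [S] := by
  rcases Nat.eq_zero_or_pos j with rfl | hj
  · obtain rfl : i = 1 := by omega
    rfl
  · rw [fishWord_of_pos hj, fishAugment, if_neg (replicate_append_north_ne_emptyWord j w),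
      jaw_replicate_append_north, drop_jaw, lowTail, if_neg hj.ne']
    split_ifs with h
    · simp
    · obtain rfl : i = j + 1 := by omega
      simp

theorem lowComposition_fishWord {i j₁ j₂ : ℕ} {w₁ w₂ : List FishStep} (hi : 0 < i)
    (hij : i ≤ j₁ + 1) (h₂ : Closes 0 [j₂] w₂) :
    lowComposition i (fishWord j₁ w₁) (fishWord j₂ w₂) =
      fishWord (i + j₂) (lowTail i j₁ w₁ w₂) := by
  rw [lowComposition, fishAugment_fishWord hi hij, fishConcat,
    if_neg (replicate_append_north_ne_emptyWord _ _), fishWord_of_pos (j := i + j₂) (by omega)]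
  rcases Nat.eq_zero_or_pos j₂ with rfl | hj
  · rw [closes_zero_iff.1 h₂]
    simp [fishWord]
  · have key (x : List FishStep) : lowTail i j₁ w₁ x = lowTail i j₁ w₁ [] ++ x := by
      unfold lowTail
      split_ifs <;> simp
    rw [fishWord_of_pos hj, if_neg (replicate_append_north_ne_emptyWord _ _),
      jaw_replicate_append_north, drop_jaw, key [S], key w₂, add_comm, List.replicate_add,
      ← List.cons_append, ← List.append_assoc (List.replicate i E), List.dropLast_concat]
    simp only [List.append_assoc, List.cons_append]

theorem fishSize_fishWord {j : ℕ} {w : List FishStep} (h : Closes 0 [j] w) :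
    fishSize (fishWord j w) = j + w.count E + w.count N := by
  rcases Nat.eq_zero_or_pos j with rfl | hj
  · rw [closes_zero_iff.1 h]
    rfl
  · rw [fishWord_of_pos hj]
    simp [fishSize, List.count_replicate]
    ring

theorem count_lowTail {i j₁ : ℕ} {w₁ : List FishStep} (w₂ : List FishStep) (hi : 0 < i)
    (hij : i ≤ j₁ + 1) (h₁ : Closes 0 [j₁] w₁) :
    i + (lowTail i j₁ w₁ w₂).count E + (lowTail i j₁ w₁ w₂).count N =
      j₁ + w₁.count E + w₁.count N + (w₂.count E + w₂.count N) + 1 := by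
  unfold lowTail
  split_ifs with h₀ h
  · subst h₀
    rw [closes_zero_iff.1 h₁]
    simp
    omega
  · simp [List.count_replicate]
    omega
  · simp
    omega

theorem not_mem_lowTail_iff {i j₁ : ℕ} {w₁ w₂ : List FishStep} (h₁ : Closes 0 [j₁] w₁) :
    V ∉ lowTail i j₁ w₁ w₂ ↔ (j₁ = 0 ∨ i ≤ j₁) ∧ V ∉ w₁ ∧ V ∉ w₂ := by
  unfold lowTail
  split_ifs with h₀ h
  · subst h₀
    rw [closes_zero_iff.1 h₁]
    simp
  · simp [h, List.mem_replicate]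
  · simp [h₀, h]

theorem unmark_replicate_append_north (j : ℕ) (w : List FishStep) :
    unmark (List.replicate j E ++ N :: w) = List.replicate j E ++ N :: unmark w := by
  rw [unmark_append, unmark_replicate, unmark_cons]
  rfl

/-- Every non-empty extended fighting fish satisfies the grammar. -/
theorem exists_eq_fishWord {k : ℕ} {w : List FishStep} (h : Built k (unmark w)) :
    ∃ j w', 0 < j ∧ w = fishWord j w' ∧ Closes 0 [j] w' := by
  have key {e : ℕ} {v : List FishStep} (hv : Opens e v) (w : List FishStep) (hw : v = unmark w) :
      Opens e w := by
    induction hv generalizing w with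
    | @east e v _ ih =>
      cases w with
      | nil => simp [unmark_nil] at hw
      | cons x w =>
        cases x <;> simp [unmark_cons] at hw
        exact .east (ih w hw)
    | @north e v he h =>
      cases w with
      | nil => simp [unmark_nil] at hw
      | cons x w =>
        cases x <;> simp [unmark_cons] at hw
        rw [hw, closes_unmark_iff] at h
        exact .north he h
  obtain ⟨m, w', rfl, hm, h⟩ := (key h.opens w rfl).exists_eq
  rw [zero_add] at hm h
  exact ⟨m, w', hm, (fishWord_of_pos hm w').symm, h⟩

theorem isFish_fishWord_iff {j : ℕ} {w : List FishStep} (h : Closes 0 [j] w)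
    (hw : IsExtFish (fishWord j w)) : IsFish (fishWord j w) ↔ V ∉ w := by
  rcases Nat.eq_zero_or_pos j with rfl | hj
  · rw [closes_zero_iff.1 h]
    simp [fishWord, IsFish]
  · have hne := replicate_append_north_ne_emptyWord j w
    rw [fishWord_of_pos hj] at hw ⊢
    refine ⟨fun h => ?_, fun hV => ?_⟩
    · obtain ⟨k, hk⟩ := h.resolve_left hne
      exact fun hV => hk.not_mem_V (by simp [hV])
    · obtain ⟨k, hk⟩ := hw.resolve_left hne
      rw [unmark_replicate_append_north, unmark_eq_self hV] at hk
      exact Or.inr ⟨k, hk⟩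

/-- The number of cells of a low composition, expressed for the words after the jaw. For the empty
fish, with no cell, the word is `S`. -/
theorem Built.lowTail {i j₁ j₂ k₁ k₂ : ℕ} {w₁ w₂ : List FishStep} (hi : 0 < i) (hij : i ≤ j₁ + 1)
    (h₁ : (j₁ = 0 ∧ k₁ = 0) ∨ Built k₁ (unmark (List.replicate j₁ E ++ N :: w₁)))
    (h₂ : (j₂ = 0 ∧ w₂ = [S] ∧ k₂ = 0) ∨ Built k₂ (unmark (List.replicate j₂ E ++ N :: w₂))) :
    Built (k₁ + i + k₂)
      (unmark (List.replicate (i + j₂) E ++ N :: TamariFish.lowTail i j₁ w₁ w₂)) := by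
  -- the augmentation, with its last letter `S` split off
  have aug : ∃ g, (∀ x, unmark (N :: TamariFish.lowTail i j₁ w₁ x) = g ++ unmark x) ∧
      Built (k₁ + i) (List.replicate i E ++ g ++ [S]) := by
    rcases Nat.eq_zero_or_pos j₁ with rfl | hj
    · obtain rfl : i = 1 := by omega
      have hk : k₁ = 0 := by
        rcases h₁ with h | h
        · exact h.2
        · cases h.opens with
          | north h _ => exact absurd h (lt_irrefl 0)
      subst hk
      exact ⟨[N, W], fun x => rfl, Built.head⟩
    · replace h₁ := h₁.resolve_left (by omega)
      rw [unmark_replicate_append_north] at h₁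
      by_cases hle : i ≤ j₁
      · refine ⟨N :: (List.replicate (j₁ - i) E ++ N :: unmark w₁), fun x => ?_, ?_⟩
        · rw [TamariFish.lowTail, if_neg hj.ne', if_pos hle, unmark_cons,
            unmark_replicate_append_north, unmark_append]
          simp
        · have := Built.augment (w := List.replicate (j₁ - i) E ++ N :: unmark w₁) hi
            (by rwa [← List.append_assoc, ← List.replicate_add, Nat.add_sub_cancel' hle])
          simpa using this
      · obtain rfl : i = j₁ + 1 := by omega
        refine ⟨N :: W :: N :: unmark w₁, fun x => ?_, ?_⟩
        · rw [TamariFish.lowTail, if_neg hj.ne', if_neg hle, unmark_cons, unmark_cons,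
            unmark_append]
          simp
        · -- the last cell of the new row sticks out
          have := Built.lower (List.replicate j₁ E) (N :: (unmark w₁ ++ [S]))
            (by simpa using Built.augment (w := N :: unmark w₁) hj h₁)
          simpa [List.replicate_succ', add_assoc] using this
  obtain ⟨g, hg, haug⟩ := aug
  rw [unmark_append, unmark_replicate, hg]
  rcases h₂ with ⟨rfl, rfl, rfl⟩ | h₂
  · simpa [unmark] using haug
  · rw [unmark_replicate_append_north] at h₂
    have := Built.concat haug h₂
    rw [add_comm i, List.replicate_add, add_comm _ k₂]
    simpa only [List.append_assoc] using this

/-! ### The correspondence -/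

/-- `Corr I j w`: the fish that corresponds to the Tamari interval `I` has jaw length `j` and steps
`w` after the letter that ends the jaw. -/
inductive Corr : TamariInterval → ℕ → List FishStep → Prop
  | empty : Corr .empty 0 [S]
  | composition {J : PointedInterval} {I₂ : TamariInterval} {j₁ j₂ : ℕ} {w₁ w₂ : List FishStep} :
      Corr J.interval j₁ w₁ → Corr I₂ j₂ w₂ →
        Corr (J.leftComposition I₂) (J.index + j₂) (lowTail J.index j₁ w₁ w₂)

theorem PointedInterval.index_pos (J : PointedInterval) : 0 < J.index := Nat.succ_pos _

namespace Corr

theorem c₀_eq {I : TamariInterval} {j : ℕ} {w : List FishStep} (h : Corr I j w) : I.c₀ = j := by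
  induction h with
  | empty => rfl
  | composition _ _ ih₁ ih₂ => rw [PointedInterval.c₀_leftComposition, ih₂]

theorem index_le {J : PointedInterval} {j : ℕ} {w : List FishStep} (h : Corr J.interval j w) :
    J.index ≤ j + 1 := h.c₀_eq ▸ J.index_le

theorem closes {I : TamariInterval} {j : ℕ} {w : List FishStep} (h : Corr I j w) :
    Closes 0 [j] w := by
  induction h with
  | empty => exact .south .nil
  | @composition J I₂ _ _ _ _ h₁ h₂ ih₁ ih₂ => exact closes_lowTail J.index_pos h₁.index_le ih₁ ih₂

theorem total (I : TamariInterval) : ∃ j w, Corr I j w := by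
  induction I using TamariInterval.composition_induction with
  | empty => exact ⟨_, _, .empty⟩
  | composition J I₂ h₁ h₂ =>
    obtain ⟨_, _, h₁⟩ := h₁
    obtain ⟨_, _, h₂⟩ := h₂
    exact ⟨_, _, .composition h₁ h₂⟩

theorem leftComposition_ne_empty (J : PointedInterval) (I₂ : TamariInterval) :
    J.leftComposition I₂ ≠ .empty := by
  intro h
  have := congrArg TamariInterval.size h
  rw [J.size_leftComposition] at this
  simp [TamariInterval.size, TamariInterval.empty] at this

theorem functional {I : TamariInterval} {j j' : ℕ} {w w' : List FishStep} (h : Corr I j w)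
    (h' : Corr I j' w') : j = j' ∧ w = w' := by
  induction h generalizing j' w' with
  | empty =>
    generalize hI : TamariInterval.empty = I at h'
    cases h' with
    | empty => exact ⟨rfl, rfl⟩
    | composition _ _ => exact absurd hI.symm (leftComposition_ne_empty _ _)
  | @composition J I₂ _ _ _ _ h₁ h₂ ih₁ ih₂ =>
    generalize hI : J.leftComposition I₂ = I at h'
    cases h' with
    | empty => exact absurd hI (leftComposition_ne_empty _ _)
    | composition h₁' h₂' =>
      obtain ⟨rfl, rfl⟩ := PointedInterval.leftComposition_inj.1 hI
      obtain ⟨rfl, rfl⟩ := ih₁ h₁'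
      obtain ⟨rfl, rfl⟩ := ih₂ h₂'
      exact ⟨rfl, rfl⟩

/-- The index of the composition determines the factorization of the lower path. -/
theorem injective {I I' : TamariInterval} {j : ℕ} {w : List FishStep} (h : Corr I j w)
    (h' : Corr I' j w) : I = I' := by
  induction h generalizing I' with
  | empty =>
    generalize hj : 0 = j at h'
    generalize [S] = w at h'
    cases h' with
    | empty => rfl
    | @composition J _ _ _ _ _ _ _ =>
      have := J.index_pos
      omega
  | @composition J I₂ j₁ j₂ w₁ w₂ h₁ h₂ ih₁ ih₂ =>
    generalize hj : J.index + j₂ = j at h'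
    generalize hw : lowTail J.index j₁ w₁ w₂ = w at h'
    cases h' with
    | empty =>
      have := J.index_pos
      omega
    | @composition J' I₂' j₁' j₂' w₁' w₂' h₁' h₂' =>
      obtain ⟨hi, rfl, rfl, rfl, rfl⟩ := lowTail_inj J.index_pos h₁.index_le h₁.closes h₂.closes
        J'.index_pos h₁'.index_le h₁'.closes h₂'.closes hw
      rw [ih₂ h₂', PointedInterval.ext_index (ih₁ h₁') hi]

/-- The decomposition of fish ends, since both factors of a low composition are smaller. -/
theorem surjective {j : ℕ} {w : List FishStep} (h : Closes 0 [j] w) : ∃ I, Corr I j w := by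
  induction hn : j + w.count E + w.count N using Nat.strong_induction_on generalizing j w with
  | _ n ih =>
    rcases h.exists_eq_lowTail with ⟨rfl, rfl⟩ | ⟨i, j₁, j₂, w₁, w₂, hi, hij, h₁, h₂, rfl, rfl⟩
    · exact ⟨_, .empty⟩
    · have hc := count_lowTail w₂ hi hij h₁
      obtain ⟨I₁, hI₁⟩ := ih _ (by omega) h₁ rfl
      obtain ⟨I₂, hI₂⟩ := ih _ (by omega) h₂ rfl
      obtain ⟨J, rfl, rfl⟩ := PointedInterval.exists_index_eq I₁ hi (by rwa [hI₁.c₀_eq])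
      exact ⟨_, .composition hI₁ hI₂⟩

theorem count_eq {I : TamariInterval} {j : ℕ} {w : List FishStep} (h : Corr I j w) :
    j + w.count E + w.count N = I.size := by
  induction h with
  | empty => rfl
  | @composition J I₂ j₁ j₂ w₁ w₂ h₁ h₂ ih₁ ih₂ =>
    have := count_lowTail w₂ J.index_pos h₁.index_le h₁.closes
    rw [J.size_leftComposition]
    omega

theorem built {I : TamariInterval} {j : ℕ} {w : List FishStep} (h : Corr I j w) :
    (j = 0 ∧ w = [S] ∧ I.distance + I.size = 0) ∨
      Built (I.distance + I.size) (unmark (List.replicate j E ++ N :: w)) := by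
  induction h with
  | empty => exact Or.inl ⟨rfl, rfl, by rw [TamariInterval.distance_empty]; rfl⟩
  | @composition J I₂ j₁ j₂ w₁ w₂ h₁ h₂ ih₁ ih₂ =>
    have := Built.lowTail J.index_pos h₁.index_le (ih₁.imp_left fun h => ⟨h.1, h.2.2⟩) ih₂
    rw [J.distance_leftComposition, J.size_leftComposition]
    refine Or.inr ?_
    convert this using 1
    rw [PointedInterval.index]
    omega

theorem isSynchronized_iff {I : TamariInterval} {j : ℕ} {w : List FishStep} (h : Corr I j w) :
    I.IsSynchronized ↔ V ∉ w := by
  induction h with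
  | empty => simp [TamariInterval.IsSynchronized, TamariInterval.empty]
  | @composition J I₂ j₁ j₂ w₁ w₂ h₁ h₂ ih₁ ih₂ =>
    rw [J.isSynchronized_leftComposition_iff, not_mem_lowTail_iff h₁.closes, ih₁, ih₂, h₁.c₀_eq]

theorem hasCells {I : TamariInterval} {j : ℕ} {w : List FishStep} (h : Corr I j w) :
    HasCells (fishWord j w) (I.distance + I.size) := by
  rcases Nat.eq_zero_or_pos j with rfl | hj
  · rcases h.built with ⟨-, -, hk⟩ | h'
    · exact Or.inl ⟨rfl, hk⟩
    · cases h'.opens with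
      | north h _ => exact absurd h (lt_irrefl 0)
  · rw [fishWord_of_pos hj]
    exact Or.inr (h.built.resolve_left (by omega))

end Corr

theorem HasCells.area_eq {w : List FishStep} {k : ℕ} (h : HasCells w k) : area w = k := by
  rcases h with ⟨rfl, rfl⟩ | h
  · rw [area_eq_areaFrom]
    simp [emptyWord, areaFrom, lat, long]
  · rw [← area_unmark, h.area_eq]

theorem HasCells.isExtFish {w : List FishStep} {k : ℕ} (h : HasCells w k) : IsExtFish w :=
  h.imp (fun h => h.1) fun h => ⟨k, h⟩

theorem exists_corr {w : List FishStep} (hw : IsExtFish w) :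
    ∃ I j w', Corr I j w' ∧ w = fishWord j w' := by
  rcases hw with rfl | ⟨k, hk⟩
  · exact ⟨_, _, _, .empty, rfl⟩
  · obtain ⟨j, w', -, rfl, h⟩ := exists_eq_fishWord hk
    obtain ⟨I, hI⟩ := Corr.surjective h
    exact ⟨I, j, w', hI, rfl⟩

theorem FishRecursion.corr {Ψ : TamariInterval → ExtFish} (hΨ : FishRecursion Ψ)
    (I : TamariInterval) : ∃ j w, Corr I j w ∧ (Ψ I).1 = fishWord j w := by
  induction I using TamariInterval.composition_induction with
  | empty => exact ⟨0, [S], .empty, by rw [hΨ.empty]; rfl⟩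
  | composition J I₂ h₁ h₂ =>
    obtain ⟨j₁, w₁, h₁, hw₁⟩ := h₁
    obtain ⟨j₂, w₂, h₂, hw₂⟩ := h₂
    refine ⟨_, _, .composition h₁ h₂, ?_⟩
    rw [(hΨ.composition J I₂).2, hw₁, hw₂,
      lowComposition_fishWord J.index_pos h₁.index_le h₂.closes]

end TamariFish

theorem mainTheorem1 :
    ∃ Φ : TamariFish.TamariInterval → TamariFish.ExtFish,
      TamariFish.FishRecursion Φ ∧
      (∀ Ψ : TamariFish.TamariInterval → TamariFish.ExtFish,
        TamariFish.FishRecursion Ψ → Ψ = Φ) ∧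
      Function.Bijective Φ ∧
      (∀ I : TamariFish.TamariInterval,
        TamariFish.fishSize (Φ I).1 = (I.size : ℤ) ∧
        TamariFish.jaw (Φ I).1 = I.c₀ ∧
        TamariFish.area (Φ I).1 = (I.distance : ℤ) + (I.size : ℤ) ∧
        ∀ k : ℕ, TamariFish.HasCells (Φ I).1 k ↔ k = I.distance + I.size) ∧
      Set.BijOn Φ {I | I.IsSynchronized} {F | TamariFish.IsFish F.1} := by
  choose j w hcorr using TamariFish.Corr.total
  let Φ : TamariFish.TamariInterval → TamariFish.ExtFish := fun I =>
    ⟨TamariFish.fishWord (j I) (w I), (hcorr I).hasCells.isExtFish⟩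
  have eq_of_corr {I : TamariFish.TamariInterval} {j' : ℕ} {w' : List TamariFish.FishStep}
      (h : TamariFish.Corr I j' w') : (Φ I).1 = TamariFish.fishWord j' w' := by
    obtain ⟨h₁, h₂⟩ := (hcorr I).functional h
    rw [← h₁, ← h₂]
  have hbij : Function.Bijective Φ := by
    refine ⟨fun I I' h => ?_, fun F => ?_⟩
    · obtain ⟨hj, hw⟩ := TamariFish.fishWord_inj (hcorr I).closes (hcorr I').closes
        (congrArg Subtype.val h)
      have h' := hcorr I'
      rw [← hj, ← hw] at h'
      exact (hcorr I).injective h'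
    · obtain ⟨I, j', w', h, hF⟩ := TamariFish.exists_corr F.2
      exact ⟨I, Subtype.ext ((eq_of_corr h).trans hF.symm)⟩
  have hsync (I : TamariFish.TamariInterval) :
      TamariFish.IsFish (Φ I).1 ↔ I.IsSynchronized := by
    rw [(hcorr I).isSynchronized_iff]
    exact TamariFish.isFish_fishWord_iff (hcorr I).closes (Φ I).2
  refine ⟨Φ, ⟨Subtype.ext (eq_of_corr .empty), fun J I₂ => ⟨⟨J.index_pos, ?_⟩, ?_⟩⟩,
    fun Ψ hΨ => funext fun I => ?_, hbij, fun I => ⟨?_, ?_, ?_, fun k => ⟨fun hk => ?_, ?_⟩⟩, ?_⟩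
  · exact (TamariFish.jaw_fishWord _ _).symm ▸ (hcorr J.interval).index_le
  · rw [eq_of_corr (.composition (hcorr J.interval) (hcorr I₂))]
    exact (TamariFish.lowComposition_fishWord J.index_pos (hcorr J.interval).index_le
      (hcorr I₂).closes).symm
  · obtain ⟨j', w', h, hΨI⟩ := hΨ.corr I
    exact Subtype.ext (hΨI.trans (eq_of_corr h).symm)
  · exact (TamariFish.fishSize_fishWord (hcorr I).closes).trans (mod_cast (hcorr I).count_eq)
  · exact (TamariFish.jaw_fishWord _ _).trans (hcorr I).c₀_eq.symm
  · exact_mod_cast (hcorr I).hasCells.area_eq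
  · exact_mod_cast hk.area_eq.symm.trans (hcorr I).hasCells.area_eq
  · rintro rfl
    exact (hcorr I).hasCells
  · refine ⟨fun I hI => (hsync I).2 hI, hbij.1.injOn, fun F hF => ?_⟩
    obtain ⟨I, rfl⟩ := hbij.2 F
    exact ⟨I, (hsync I).1 hF, rfl⟩
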